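/- Let $\gamma\in C^{2}(0,1]$ be a real-valued function that is monotonic on $(0,1]$ and satisfies $\lim_{t\to0^+}\gamma(t)=0$. Assume moreover that (i) there are positive constants $C^{(1)}_1,C^{(2)}_1$ such that $\left|\frac{t^{j}\gamma^{(j)}(t)}{\gamma(t)}\right|\ge C^{(j)}_1$ for all $t\in(0,1]$ and $j=1,2$; (ii) there is a positive constant $C^{(1)}_2$ such that $\left|\frac{t\gamma'(t)}{\gamma(t)}\right|\le C^{(1)}_2$ for all $t\in(0,1]$. (In particular $\gamma(t)\neq0$ on $(0,1]$.) Put $$Tf(x,u):=\int_0^1 f(x_1-ut,\,x_2-u\gamma(t))\,dt,\qquad x=(x_1,x_2)\in\mathbb R^2,\ u\in[1,2],$$ $$\omega:=\limsup_{t\to0^+}\frac{\ln|\gamma(t)|}{\ln t},\qquad \vartriangle:=\left\{\left(\tfrac1p,\tfrac1q\right):\ \tfrac1{2p}\le\tfrac1q\le\tfrac1p,\ \tfrac1q\ge\tfrac2p-1\right\}.$$ Let $1\le p\le\infty$ and $0<q\le\infty$, and consider the estimate $$\|Tf(\cdot,u)\|_{L^q(\mathbb R^2)}\le C\|f\|_{L^p(\mathbb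 R^2)}\qquad\text{for all } f\in L^p(\mathbb R^2)\text{ and all }u\in[1,2],\tag{$*$}$$ with a constant $C>0$ that does not depend on $f$ or $u$. If $\left(\frac1p,\frac1q\right)\in\vartriangle$ and $1+(1+\omega)\left(\frac1q-\frac1p\right)>0$, then, for every $f\in L^p(\mathbb R^2)$ and $u\in[1,2]$, the integral $Tf(x,u)$ converges absolutely for almost every $x$ and defines a measurable function of $x$, and $(*)$ holds for some constant $C>0$. Conversely, if $(*)$ holds for some constant $C>0$, then $\left(\frac1p,\frac1q\right)\in\vartriangle$ and $1+(1+\omega)\left(\frac1q-\frac1p\right)\ge0$. -/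

import Mathlib

open MeasureTheory Set Filter Topology
open scoped ENNReal

noncomputable section

/-- The integrand of the averaging operator: the function `f` along the dilated curve
`t ↦ (u t, u γ(t))` reflected at and translated to the point `x`. -/
def alongCurve (γ : ℝ → ℝ) (f : ℝ × ℝ → ℂ) (x : ℝ × ℝ) (u t : ℝ) : ℂ :=
  f (x.1 - u * t, x.2 - u * γ t)

/-- The operator `T f (x, u) = ∫₀¹ f (x₁ - u t, x₂ - u γ(t)) dt`. -/
def curveAverage (γ : ℝ → ℝ) (f : ℝ × ℝ → ℂ) (x : ℝ × ℝ) (u : ℝ) : ℂ :=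
  ∫ t in (0 : ℝ)..1, alongCurve γ f x u t

/-- `ω = limsup_{t → 0+} ln |γ(t)| / ln t`. (If `|t γ'(t) / γ(t)|` is bounded above and below by
positive constants on `(0, 1]` and `γ(t) → 0`, the quotient is bounded near `0`, so this is the
usual limsup.) -/
def curveExponent (γ : ℝ → ℝ) : ℝ :=
  limsup (fun t : ℝ => Real.log |γ t| / Real.log t) (𝓝[>] 0)

/-- The closed triangle of the points `(1/p, 1/q)` with `1/(2p) ≤ 1/q ≤ 1/p` and
`1/q ≥ 2/p - 1`. -/
def exponentTriangle : Set (ℝ × ℝ) :=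
  {z | z.1 / 2 ≤ z.2 ∧ z.2 ≤ z.1 ∧ 2 * z.1 - 1 ≤ z.2}

/-- The estimate `‖T f (·, u)‖_{L^q(ℝ²)} ≤ C ‖f‖_{L^p(ℝ²)}` for all `f ∈ L^p(ℝ²)`, with one
constant `C` for all `u ∈ [1, 2]`. -/
def UniformLpLqEstimate (γ : ℝ → ℝ) (p q : ℝ≥0∞) : Prop :=
  ∃ C : ℝ, 0 < C ∧ ∀ u ∈ Icc (1 : ℝ) 2, ∀ f : ℝ × ℝ → ℂ, MemLp f p volume →
    eLpNorm (fun x => curveAverage γ f x u) q volume ≤ ENNReal.ofReal C * eLpNorm f p volume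

/-- The operators `T (·, u)`, `u ∈ [1, 2]`, are well defined on `L^p(ℝ²)`: the defining integral
converges absolutely for almost every `x`, and the result is a measurable function of `x`. -/
def WellDefinedOnLp (γ : ℝ → ℝ) (p : ℝ≥0∞) : Prop :=
  ∀ u ∈ Icc (1 : ℝ) 2, ∀ f : ℝ × ℝ → ℂ, MemLp f p volume →
    (∀ᵐ x : ℝ × ℝ, IntervalIntegrable (fun t => alongCurve γ f x u t) volume 0 1) ∧
      AEStronglyMeasurable (fun x => curveAverage γ f x u) volume

end

/-! Sufficiency rests on the endpoint (1/p, 1/q) = (2/3, 1/3), proved without Fourier analysis. For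
a piece of the curve, the cube of the average of F is a triple integral of F(x-Γa)F(x-Γb)F(x-Γs).
Put g = F^(3/2). Since the three permuted copies of `tripleWeight` multiply to 1 off the diagonals,
the integrand is the geometric mean of three terms such as g(x-Γa)g(x-Γb)W(a,b,s), and Hölder
reduces the claim to one of them (`lintegral_translateAverage_pow_three_le`). Integrating out s
leaves O(|a-b|), which is, up to the curvature constant κ, a lower bound for the Jacobian of (a,b) ↦
Γa-Γb (`lintegral_difference_le`). The term is therefore O(κ⁻¹‖g‖₁²).

The triangle has vertices (0,0), (1,1) and (2/3,1/3), so pointwise Hölder with the trivial L^∞ and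
L¹ bounds covers all of it. On the dyadic piece t ~ r = 2^(-k), for any α > ω, |γ| ≥ c t^α and the
lower bound on t²γ''/γ give curvature κ ≳ r^(α-2). With δ = 1/p - 1/q the norm of the piece is
O(r^(1-3δ) κ^(-δ)) = O(r^(1-(1+α)δ)). The strict inequality in the hypothesis leaves room for an α
making this a convergent geometric series.

Necessity tests the estimate at u = 1 on indicators: large boxes (q⁻¹ ≤ p⁻¹), a small box against a
neighbourhood of the curve and the reverse (the other two sides), and boxes ε × |γ(ε)| at the
origin, which see the flatness of γ and hence ω. -/

/-! ### The three-parameter singular weight. -/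

theorem lintegral_Ioc_rpow_neg_two_thirds {d : ℝ} (hd : 0 < d) :
    ∫⁻ r in Ioc 0 d, ENNReal.ofReal (r ^ (-(2 / 3) : ℝ)) = ENNReal.ofReal (3 * d ^ (1 / 3 : ℝ)) := by
  have hi : IntervalIntegrable (fun r : ℝ => r ^ (-(2 / 3) : ℝ)) volume 0 d :=
    intervalIntegral.intervalIntegrable_rpow' (by norm_num)
  rw [intervalIntegrable_iff_integrableOn_Ioc_of_le hd.le] at hi
  rw [← ofReal_integral_eq_lintegral_ofReal hi, ← intervalIntegral.integral_of_le hd.le,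
    integral_rpow (Or.inl (by norm_num))]
  · congr 1
    rw [Real.zero_rpow (by norm_num)]
    norm_num
    ring
  · filter_upwards [ae_restrict_mem measurableSet_Ioc] with r hr
    exact Real.rpow_nonneg hr.1.le _

theorem lintegral_Ioi_rpow_neg_four_thirds {d : ℝ} (hd : 0 < d) :
    ∫⁻ r in Ioi d, ENNReal.ofReal (r ^ (-(4 / 3) : ℝ)) =
      ENNReal.ofReal (3 * d ^ (-(1 / 3) : ℝ)) := by
  have hi := integrableOn_Ioi_rpow_of_lt (a := (-(4 / 3) : ℝ)) (by norm_num) hd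
  rw [← ofReal_integral_eq_lintegral_ofReal hi,
    integral_Ioi_rpow_of_lt (by norm_num) hd]
  · congr 1
    norm_num
    ring
  · filter_upwards [ae_restrict_mem measurableSet_Ioi] with r hr
    exact Real.rpow_nonneg (hd.le.trans (le_of_lt hr)) _

/-- The truncated singular kernel `|r|^(-2/3) max(d,|r|)^(-2/3)` has integral of order
`d^(-1/3)`. -/
theorem lintegral_truncated_kernel {d : ℝ} (hd : 0 < d) :
    ∫⁻ r : ℝ, ENNReal.ofReal (|r| ^ (-(2 / 3) : ℝ) * (max d |r|) ^ (-(2 / 3) : ℝ)) ≤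
      ENNReal.ofReal (12 * d ^ (-(1 / 3) : ℝ)) := by
  set f : ℝ → ℝ≥0∞ :=
    fun r => ENNReal.ofReal (|r| ^ (-(2 / 3) : ℝ) * (max d |r|) ^ (-(2 / 3) : ℝ)) with hf
  have hfm : Measurable f := by
    simp only [hf]
    fun_prop
  set g : ℝ → ℝ≥0∞ := (Ioi (0 : ℝ)).indicator f with hg
  have hgm : Measurable g := hfm.indicator measurableSet_Ioi
  have hle : ∀ r, f r ≤ g r + g (-r) := by
    intro r
    rcases lt_trichotomy r 0 with h | h | h
    · have : g (-r) = f r := by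
        simp [hg, hf, h]
      rw [this]
      exact le_add_self
    · subst h
      -- Real powers satisfy 0^(-2/3) = 0, so the kernel vanishes at its singularity.
      simp [hf, Real.zero_rpow (show (-(2 / 3) : ℝ) ≠ 0 by norm_num)]
    · have : g r = f r := by
        simp [hg, h]
      rw [this]
      exact le_self_add
  have hneg : ∫⁻ r, g (-r) = ∫⁻ r, g r := lintegral_neg_eq_self g
  have hIoi : ∫⁻ r, g r ≤ ENNReal.ofReal (6 * d ^ (-(1 / 3) : ℝ)) := by
    rw [hg, lintegral_indicator measurableSet_Ioi, ← Ioc_union_Ioi_eq_Ioi hd.le,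
      lintegral_union measurableSet_Ioi (Ioc_disjoint_Ioi le_rfl)]
    have h1 : ∫⁻ r in Ioc 0 d, f r = ENNReal.ofReal (3 * d ^ (-(1 / 3) : ℝ)) := by
      have : ∫⁻ r in Ioc 0 d, f r = ∫⁻ r in Ioc 0 d,
          ENNReal.ofReal (d ^ (-(2 / 3) : ℝ)) * ENNReal.ofReal (r ^ (-(2 / 3) : ℝ)) := by
        refine setLIntegral_congr_fun measurableSet_Ioc fun r hr => ?_
        simp only [hf]
        rw [abs_of_pos hr.1, max_eq_left hr.2, ← ENNReal.ofReal_mul (by positivity), mul_comm]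
      rw [this, lintegral_const_mul _ (by fun_prop), lintegral_Ioc_rpow_neg_two_thirds hd,
        ← ENNReal.ofReal_mul (by positivity)]
      congr 1
      rw [mul_left_comm, ← Real.rpow_add hd]
      norm_num
    have h2 : ∫⁻ r in Ioi d, f r = ENNReal.ofReal (3 * d ^ (-(1 / 3) : ℝ)) := by
      rw [← lintegral_Ioi_rpow_neg_four_thirds hd]
      refine setLIntegral_congr_fun measurableSet_Ioi fun r hr => ?_
      have hr' : 0 < r := hd.trans hr
      simp only [hf]
      rw [abs_of_pos hr', max_eq_right (le_of_lt hr), ← Real.rpow_add hr']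
      norm_num
    rw [h1, h2, ← ENNReal.ofReal_add (by positivity) (by positivity)]
    apply le_of_eq
    congr 1
    ring
  calc ∫⁻ r, f r ≤ ∫⁻ r, (g r + g (-r)) := lintegral_mono hle
    _ = (∫⁻ r, g r) + ∫⁻ r, g r := by rw [lintegral_add_left hgm, hneg]
    _ ≤ ENNReal.ofReal (6 * d ^ (-(1 / 3) : ℝ)) + ENNReal.ofReal (6 * d ^ (-(1 / 3) : ℝ)) := by
        gcongr
    _ = _ := by
        rw [← ENNReal.ofReal_add (by positivity) (by positivity)]
        congr 1
        ring

/-- The weight `|a-b|^(4/3) |a-s|^(-2/3) |b-s|^(-2/3)`. -/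
noncomputable def tripleWeight (a b s : ℝ) : ℝ≥0∞ :=
  ENNReal.ofReal (|a - b| ^ (4 / 3 : ℝ) * |a - s| ^ (-(2 / 3) : ℝ) * |b - s| ^ (-(2 / 3) : ℝ))

@[fun_prop]
theorem Measurable.tripleWeight {α : Type*} [MeasurableSpace α] {f g h : α → ℝ}
    (hf : Measurable f) (hg : Measurable g) (hh : Measurable h) :
    Measurable fun x => tripleWeight (f x) (g x) (h x) := by
  unfold _root_.tripleWeight
  fun_prop

/-- The product |a-s|^(-2/3)|b-s|^(-2/3) is integrable at both singularities and, with decay 4/3, at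
infinity; by scaling its integral is of order |a-b|^(-1/3). The prefactor |a-b|^(4/3) is chosen so
that exactly the Jacobian factor |a-b| remains. -/
theorem lintegral_tripleWeight_le (a b : ℝ) :
    ∫⁻ s, tripleWeight a b s ≤ 48 * ‖a - b‖ₑ := by
  rcases eq_or_ne a b with rfl | hab
  · simp [tripleWeight]
  set d := |a - b| / 2 with hd
  have hd0 : 0 < d := by
    have := abs_pos.mpr (sub_ne_zero.mpr hab)
    positivity
  have hab2 : |a - b| = 2 * d := by rw [hd]; ring
  set φ : ℝ → ℝ := fun r => |r| ^ (-(2 / 3) : ℝ) * (max d |r|) ^ (-(2 / 3) : ℝ) with hφ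
  have hφ0 : ∀ r, 0 ≤ φ r := fun r => by simp only [hφ]; positivity
  have hφm : Measurable φ := by simp only [hφ]; fun_prop
  -- The point farther from s is at distance at least d = |a-b|/2, and at least as far as the nearer
  -- one. Hence the truncated kernel centred at the nearer point dominates.
  have key : ∀ s, |a - s| ^ (-(2 / 3) : ℝ) * |b - s| ^ (-(2 / 3) : ℝ) ≤ φ (a - s) + φ (b - s) := by
    intro s
    have htri : |a - b| ≤ |a - s| + |b - s| := by
      have := abs_sub_le a s b
      rwa [abs_sub_comm s b] at this
    rcases le_total |a - s| |b - s| with h | h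
    · have : (|b - s|) ^ (-(2 / 3) : ℝ) ≤ (max d |a - s|) ^ (-(2 / 3) : ℝ) :=
        Real.rpow_le_rpow_of_nonpos (lt_max_of_lt_left hd0)
          (max_le (by linarith) h) (by norm_num)
      calc _ ≤ φ (a - s) := by simp only [hφ]; gcongr
        _ ≤ _ := le_add_of_nonneg_right (hφ0 _)
    · have : (|a - s|) ^ (-(2 / 3) : ℝ) ≤ (max d |b - s|) ^ (-(2 / 3) : ℝ) :=
        Real.rpow_le_rpow_of_nonpos (lt_max_of_lt_left hd0)
          (max_le (by linarith) h) (by norm_num)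
      calc _ ≤ φ (b - s) := by simp only [hφ]; rw [mul_comm]; gcongr
        _ ≤ _ := le_add_of_nonneg_left (hφ0 _)
  have h2 : ∀ c : ℝ, ∫⁻ s, ENNReal.ofReal (φ (c - s)) ≤ ENNReal.ofReal (12 * d ^ (-(1 / 3) : ℝ)) := by
    intro c
    rw [lintegral_sub_left_eq_self (fun r => ENNReal.ofReal (φ r)) c]
    exact lintegral_truncated_kernel hd0
  calc ∫⁻ s, tripleWeight a b s
      ≤ ∫⁻ s, ENNReal.ofReal (|a - b| ^ (4 / 3 : ℝ)) *
          (ENNReal.ofReal (φ (a - s)) + ENNReal.ofReal (φ (b - s))) := by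
        refine lintegral_mono fun s => ?_
        rw [← ENNReal.ofReal_add (hφ0 _) (hφ0 _), ← ENNReal.ofReal_mul (by positivity)]
        unfold tripleWeight
        rw [mul_assoc]
        gcongr
        exact key s
    _ ≤ ENNReal.ofReal (|a - b| ^ (4 / 3 : ℝ)) * (ENNReal.ofReal (12 * d ^ (-(1 / 3) : ℝ)) +
          ENNReal.ofReal (12 * d ^ (-(1 / 3) : ℝ))) := by
        rw [lintegral_const_mul _ (by fun_prop), lintegral_add_left (by fun_prop)]
        gcongr <;> exact h2 _
    -- The value is 24 · 2^(4/3) d; with 2^(4/3) ≤ 4 this is at most 96 d = 48|a-b|.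
    _ ≤ 48 * ‖a - b‖ₑ := by
        rw [← ENNReal.ofReal_add (by positivity) (by positivity),
          ← ENNReal.ofReal_mul (by positivity), Real.enorm_eq_ofReal_abs,
          show (48 : ℝ≥0∞) = ENNReal.ofReal 48 by norm_num, ← ENNReal.ofReal_mul (by norm_num)]
        apply ENNReal.ofReal_le_ofReal
        rw [hab2, Real.mul_rpow (by norm_num) hd0.le]
        have e1 : d ^ (4 / 3 : ℝ) * d ^ (-(1 / 3) : ℝ) = d := by
          rw [← Real.rpow_add hd0]; norm_num
        have e2 : (2 : ℝ) ^ (4 / 3 : ℝ) ≤ 4 := by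
          calc (2 : ℝ) ^ (4 / 3 : ℝ) ≤ 2 ^ (2 : ℝ) :=
                Real.rpow_le_rpow_of_exponent_le (by norm_num) (by norm_num)
            _ = 4 := by norm_num
        calc (2 : ℝ) ^ (4 / 3 : ℝ) * d ^ (4 / 3 : ℝ) *
              (12 * d ^ (-(1 / 3) : ℝ) + 12 * d ^ (-(1 / 3) : ℝ))
            = 24 * 2 ^ (4 / 3 : ℝ) * (d ^ (4 / 3 : ℝ) * d ^ (-(1 / 3) : ℝ)) := by ring
          _ ≤ 48 * (2 * d) := by rw [e1]; nlinarith

/-- Each pairwise distance occurs once with exponent 4/3 and twice with -2/3. Distinctness matters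
because 0^(-2/3) = 0 makes the product vanish on the diagonals. -/
theorem tripleWeight_mul_eq_one {a b s : ℝ} (hab : a ≠ b) (has : a ≠ s) (hbs : b ≠ s) :
    tripleWeight a b s * tripleWeight a s b * tripleWeight b s a = 1 := by
  have h1 := abs_pos.mpr (sub_ne_zero.mpr hab)
  have h2 := abs_pos.mpr (sub_ne_zero.mpr has)
  have h3 := abs_pos.mpr (sub_ne_zero.mpr hbs)
  unfold tripleWeight
  rw [← ENNReal.ofReal_mul (by positivity), ← ENNReal.ofReal_mul (by positivity),
    ENNReal.ofReal_eq_one, abs_sub_comm s b, abs_sub_comm b a, abs_sub_comm s a]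
  have e : ∀ x : ℝ, 0 < x →
      x ^ (4 / 3 : ℝ) * x ^ (-(2 / 3) : ℝ) * x ^ (-(2 / 3) : ℝ) = 1 := by
    intro x hx
    rw [← Real.rpow_add hx, ← Real.rpow_add hx]
    norm_num
  calc _ = (|a - b| ^ (4 / 3 : ℝ) * |a - b| ^ (-(2 / 3) : ℝ) * |a - b| ^ (-(2 / 3) : ℝ)) *
      (|a - s| ^ (4 / 3 : ℝ) * |a - s| ^ (-(2 / 3) : ℝ) * |a - s| ^ (-(2 / 3) : ℝ)) *
      (|b - s| ^ (4 / 3 : ℝ) * |b - s| ^ (-(2 / 3) : ℝ) * |b - s| ^ (-(2 / 3) : ℝ)) := by ring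
    _ = 1 := by rw [e _ h1, e _ h2, e _ h3]; norm_num

/-! ### Averages over translates and the Jacobian of the difference map. -/

/-- Average of a nonnegative function over the translates `x - Γ t`, with `t` distributed according
to `ν`. -/
noncomputable def translateAverage (ν : Measure ℝ) (Γ : ℝ → ℝ × ℝ) (F : ℝ × ℝ → ℝ≥0∞)
    (x : ℝ × ℝ) : ℝ≥0∞ :=
  ∫⁻ t, F (x - Γ t) ∂ν

theorem measurable_translateAverage {ν : Measure ℝ} [SFinite ν] {Γ : ℝ → ℝ × ℝ}
    (hΓ : Measurable Γ) {F : ℝ × ℝ → ℝ≥0∞} (hF : Measurable F) :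
    Measurable (translateAverage ν Γ F) := by
  unfold translateAverage
  exact Measurable.lintegral_prod_right' (f := fun z : (ℝ × ℝ) × ℝ => F (z.1 - Γ z.2))
    (by fun_prop)

theorem lintegral_translateAverage {ν : Measure ℝ} [SFinite ν] {Γ : ℝ → ℝ × ℝ}
    (hΓ : Measurable Γ) {F : ℝ × ℝ → ℝ≥0∞} (hF : Measurable F) :
    ∫⁻ x, translateAverage ν Γ F x = ν univ * ∫⁻ x, F x := by
  unfold translateAverage
  rw [lintegral_lintegral_swap (by fun_prop)]
  simp_rw [lintegral_sub_right_eq_self F, lintegral_const, mul_comm]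

theorem lintegral_comp_mul_left_le {u : ℝ} (hu : 1 ≤ u) {f : ℝ → ℝ≥0∞} (hf : Measurable f) :
    ∫⁻ h, f (u * h) ≤ ∫⁻ h, f h := by
  have hu0 : u ≠ 0 := by positivity
  rw [← lintegral_map (f := f) (g := fun h => u * h) hf (by fun_prop),
    Real.map_volume_mul_left hu0, lintegral_smul_measure, smul_eq_mul]
  refine mul_le_of_le_one_left' ?_
  rw [ENNReal.ofReal_le_one, abs_of_pos (by positivity)]
  exact inv_le_one_of_one_le₀ hu

/-- The increment `t ↦ γ (t + h) - γ t` is injective if `γ'` has no equal values at distance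
`h`. -/
theorem injOn_increment {γ γ' : ℝ → ℝ} {I : Set ℝ} (hI : I.OrdConnected)
    (hd : ∀ t ∈ I, HasDerivWithinAt γ (γ' t) I t) {h : ℝ}
    (hne : ∀ t ∈ I, t + h ∈ I → γ' (t + h) ≠ γ' t) :
    InjOn (fun t => γ (t + h) - γ t) {t | t ∈ I ∧ t + h ∈ I} := by
  have aux : ∀ s ∈ {t | t ∈ I ∧ t + h ∈ I}, ∀ t ∈ {t | t ∈ I ∧ t + h ∈ I}, s < t →
      γ (s + h) - γ s ≠ γ (t + h) - γ t := by
    intro s hs t ht hst heq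
    have hc : ContinuousOn γ I := fun r hr => (hd r hr).continuousWithinAt
    have hsub : Icc s t ⊆ I := hI.out hs.1 ht.1
    have hsub' : ∀ r ∈ Icc s t, r + h ∈ I := fun r hr =>
      hI.out hs.2 ht.2 ⟨by linarith [hr.1], by linarith [hr.2]⟩
    have hcont : ContinuousOn (fun t => γ (t + h) - γ t) (Icc s t) :=
      (hc.comp (by fun_prop) hsub').sub (hc.mono hsub)
    have hder : ∀ r ∈ Ioo s t,
        HasDerivAt (fun t => γ (t + h) - γ t) (γ' (r + h) - γ' r) r := by
      intro r hr
      have h1 : HasDerivAt γ (γ' r) r :=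
        (hd r (hsub (Ioo_subset_Icc_self hr))).hasDerivAt
          (mem_of_superset (Icc_mem_nhds hr.1 hr.2) hsub)
      have h2 : HasDerivAt γ (γ' (r + h)) (r + h) :=
        (hd _ (hsub' r (Ioo_subset_Icc_self hr))).hasDerivAt
          (mem_of_superset (Icc_mem_nhds (add_lt_add_left hr.1 h) (add_lt_add_left hr.2 h))
            (hI.out hs.2 ht.2))
      exact (h2.comp_add_const r h).sub h1
    -- Rolle's theorem applied to the increment.
    obtain ⟨r, hr, hr0⟩ := exists_hasDerivAt_eq_zero hst hcont heq hder
    exact hne r (hsub (Ioo_subset_Icc_self hr)) (hsub' r (Ioo_subset_Icc_self hr)) (by linarith)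
  intro s hs t ht heq
  rcases lt_trichotomy s t with hst | hst | hst
  · exact absurd heq (aux s hs t ht hst)
  · exact hst
  · exact absurd heq.symm (aux t ht s hs hst)

/-- Substitute v = γ(t+h) - γ(t): the map is injective in t, and its derivative γ'(t+h) - γ'(t) has
absolute value at least κ|h|. -/
theorem setLIntegral_increment_le {γ γ' : ℝ → ℝ} {I : Set ℝ} (hI : I.OrdConnected)
    (hd : ∀ t ∈ I, HasDerivWithinAt γ (γ' t) I t) {κ : ℝ} (hκ : 0 < κ)
    (hcurv : ∀ s ∈ I, ∀ t ∈ I, κ * |s - t| ≤ |γ' s - γ' t|) (g : ℝ → ℝ≥0∞) (h : ℝ) :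
    (∫⁻ t in {t | t ∈ I ∧ t + h ∈ I}, g (γ (t + h) - γ t)) * ‖h‖ₑ ≤
      ENNReal.ofReal κ⁻¹ * ∫⁻ v, g v := by
  rcases eq_or_ne h 0 with rfl | hh
  · simp
  set S := {t | t ∈ I ∧ t + h ∈ I} with hS
  have hSm : MeasurableSet S :=
    hI.measurableSet.inter (measurable_id.add_const h hI.measurableSet)
  have hcurv' : ∀ t ∈ S, κ * |h| ≤ |γ' (t + h) - γ' t| := fun t ht => by
    simpa using hcurv _ ht.2 _ ht.1
  have hinj : InjOn (fun t => γ (t + h) - γ t) S := by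
    refine injOn_increment hI hd fun t ht ht' heq => ?_
    have h1 := hcurv' t ⟨ht, ht'⟩
    have h2 := abs_pos.mpr hh
    rw [heq, sub_self, abs_zero] at h1
    have := mul_pos hκ h2
    linarith
  have hder : ∀ t ∈ S,
      HasDerivWithinAt (fun t => γ (t + h) - γ t) (γ' (t + h) - γ' t) S t := by
    intro t ht
    have h1 : HasDerivWithinAt (fun t => γ (t + h)) (γ' (t + h) * 1) S t :=
      (hd _ ht.2).comp t ((hasDerivWithinAt_id t S).add_const h) fun r hr => hr.2
    rw [mul_one] at h1
    exact h1.sub ((hd t ht.1).mono fun r hr => hr.1)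
  have hcv := lintegral_image_eq_lintegral_abs_deriv_mul hSm hder hinj g
  calc (∫⁻ t in S, g (γ (t + h) - γ t)) * ‖h‖ₑ
      = ∫⁻ t in S, g (γ (t + h) - γ t) * ‖h‖ₑ := by
        rw [lintegral_mul_const' _ _ enorm_ne_top]
    _ ≤ ∫⁻ t in S, ENNReal.ofReal κ⁻¹ *
          (ENNReal.ofReal |γ' (t + h) - γ' t| * g (γ (t + h) - γ t)) := by
        refine setLIntegral_mono' hSm fun t ht => ?_
        rw [← mul_assoc, ← ENNReal.ofReal_mul (by positivity), mul_comm, Real.enorm_eq_ofReal_abs]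
        gcongr
        rw [← div_eq_inv_mul, le_div_iff₀ hκ, mul_comm]
        exact hcurv' t ht
    _ = ENNReal.ofReal κ⁻¹ * ∫⁻ v in (fun t => γ (t + h) - γ t) '' S, g v := by
        rw [lintegral_const_mul' _ _ ENNReal.ofReal_ne_top, hcv]
    _ ≤ ENNReal.ofReal κ⁻¹ * ∫⁻ v, g v := by
        gcongr
        exact Measure.restrict_le_self

/-- The difference map `(s, t) ↦ u (s - t, γ s - γ t)` of a curve with curvature at least `κ`
has Jacobian at least `κ |s - t|`. -/
theorem lintegral_difference_le {γ γ' : ℝ → ℝ} (hγ : Measurable γ) {I : Set ℝ}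
    (hI : I.OrdConnected) (hd : ∀ t ∈ I, HasDerivWithinAt γ (γ' t) I t) {κ : ℝ} (hκ : 0 < κ)
    (hcurv : ∀ s ∈ I, ∀ t ∈ I, κ * |s - t| ≤ |γ' s - γ' t|) {u : ℝ} (hu : 1 ≤ u)
    {G : ℝ × ℝ → ℝ≥0∞} (hG : Measurable G) :
    ∫⁻ s in I, ∫⁻ t in I, G ((u * s, u * γ s) - (u * t, u * γ t)) * ‖s - t‖ₑ ≤
      ENNReal.ofReal κ⁻¹ * ∫⁻ x, G x := by
  have hIm := hI.measurableSet
  set H : ℝ → ℝ → ℝ≥0∞ := fun s t =>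
    I.indicator 1 s * I.indicator 1 t * (G ((u * s, u * γ s) - (u * t, u * γ t)) * ‖s - t‖ₑ)
    with hH
  have hind : Measurable (I.indicator (1 : ℝ → ℝ≥0∞)) := measurable_one.indicator hIm
  have hHm : Measurable fun z : ℝ × ℝ => H z.1 z.2 := by
    simp only [hH]
    fun_prop
  have h1 : ∫⁻ s in I, ∫⁻ t in I, G ((u * s, u * γ s) - (u * t, u * γ t)) * ‖s - t‖ₑ =
      ∫⁻ s, ∫⁻ t, H s t := by
    rw [← lintegral_indicator hIm]
    refine lintegral_congr fun s => ?_
    by_cases hs : s ∈ I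
    · rw [indicator_of_mem hs, ← lintegral_indicator hIm]
      refine lintegral_congr fun t => ?_
      by_cases ht : t ∈ I <;> simp [hH, hs, ht]
    · simp [hH, hs]
  -- The indicators make the domain of integration independent of the variables, so s = t + h is a
  -- plain translation.
  have h2 : ∫⁻ s, ∫⁻ t, H s t = ∫⁻ h, ∫⁻ t, H (t + h) t := by
    rw [lintegral_lintegral_swap hHm.aemeasurable,
      ← lintegral_lintegral_swap (f := fun t h => H (t + h) t)]
    · refine lintegral_congr fun t => ?_
      exact (lintegral_add_left_eq_self (fun s => H s t) t).symm
    · exact (hHm.comp (f := fun z : ℝ × ℝ => (z.1 + z.2, z.1)) (by fun_prop)).aemeasurable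
  have h3 : ∀ h, ∫⁻ t, H (t + h) t ≤ ENNReal.ofReal κ⁻¹ * ∫⁻ v, G (u * h, v) := by
    intro h
    have hSm : MeasurableSet {t | t ∈ I ∧ t + h ∈ I} :=
      hIm.inter (measurable_id.add_const h hIm)
    have hle : ∫⁻ v, G (u * h, u * v) ≤ ∫⁻ v, G (u * h, v) :=
      lintegral_comp_mul_left_le (f := fun v => G (u * h, v)) hu (by fun_prop)
    refine le_trans ?_ ((setLIntegral_increment_le hI hd hκ hcurv
      (fun v => G (u * h, u * v)) h).trans (by gcongr))
    rw [← lintegral_mul_const' _ _ enorm_ne_top, ← lintegral_indicator hSm]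
    refine le_of_eq (lintegral_congr fun t => ?_)
    by_cases ht : t ∈ I
    · by_cases hth : t + h ∈ I
      · rw [indicator_of_mem (show t ∈ {t | t ∈ I ∧ t + h ∈ I} from ⟨ht, hth⟩)]
        simp only [hH, ht, hth, indicator_of_mem, Pi.one_apply, one_mul, Prod.mk_sub_mk,
          add_sub_cancel_left, ← mul_sub]
      · rw [indicator_of_notMem (fun hm => hth hm.2)]
        simp [hH, hth]
    · rw [indicator_of_notMem (fun hm => ht hm.1)]
      simp [hH, ht]
  calc _ = ∫⁻ h, ∫⁻ t, H (t + h) t := by rw [h1, h2]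
    _ ≤ ∫⁻ h, ENNReal.ofReal κ⁻¹ * ∫⁻ v, G (u * h, v) := lintegral_mono h3
    _ = ENNReal.ofReal κ⁻¹ * ∫⁻ h, ∫⁻ v, G (u * h, v) :=
        lintegral_const_mul' _ _ ENNReal.ofReal_ne_top
    _ ≤ ENNReal.ofReal κ⁻¹ * ∫⁻ h, ∫⁻ v, G (h, v) := by
        refine mul_le_mul_right ?_ _
        exact lintegral_comp_mul_left_le (f := fun h => ∫⁻ v, G (h, v)) hu hG.lintegral_prod_right'
    _ = ENNReal.ofReal κ⁻¹ * ∫⁻ x, G x := by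
        rw [Measure.volume_eq_prod, lintegral_prod _ hG.aemeasurable]

/-! ### The endpoint estimate from L^(3/2) to L³. -/

/-- A weighted bilinear estimate at `L¹ × L¹`. -/
theorem lintegral_tripleWeight_bilinear_le {ν : Measure ℝ} [SFinite ν] (hν : ν ≤ volume)
    {Γ : ℝ → ℝ × ℝ} (hΓ : Measurable Γ) {A : ℝ≥0∞}
    (hA : ∀ G : ℝ × ℝ → ℝ≥0∞, Measurable G →
      ∫⁻ s, ∫⁻ t, G (Γ s - Γ t) * ‖s - t‖ₑ ∂ν ∂ν ≤ A * ∫⁻ x, G x)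
    {g : ℝ × ℝ → ℝ≥0∞} (hg : Measurable g) :
    ∫⁻ x, ∫⁻ a, ∫⁻ b, ∫⁻ s, g (x - Γ a) * g (x - Γ b) * tripleWeight a b s ∂ν ∂ν ∂ν ≤
      48 * A * (∫⁻ x, g x) ^ 2 := by
  have h1 : ∀ x a b, ∫⁻ s, g (x - Γ a) * g (x - Γ b) * tripleWeight a b s ∂ν ≤
      48 * (g (x - Γ a) * g (x - Γ b) * ‖a - b‖ₑ) := by
    intro x a b
    rw [lintegral_const_mul _ (by fun_prop)]
    calc _ ≤ g (x - Γ a) * g (x - Γ b) * (48 * ‖a - b‖ₑ) := by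
          gcongr
          exact (lintegral_mono' hν le_rfl).trans (lintegral_tripleWeight_le a b)
      _ = _ := by ring
  have hm : Measurable fun z : ((ℝ × ℝ) × ℝ) × ℝ =>
      g (z.1.1 - Γ z.1.2) * g (z.1.1 - Γ z.2) * ‖z.1.2 - z.2‖ₑ := by fun_prop
  have hm2 : Measurable fun z : ((ℝ × ℝ) × ℝ) × ℝ =>
      g z.1.1 * (g (z.1.1 + (Γ z.1.2 - Γ z.2)) * ‖z.1.2 - z.2‖ₑ) := by fun_prop
  have hswap : ∀ f : ℝ × ℝ → ℝ → ℝ → ℝ≥0∞, (Measurable fun z : ((ℝ × ℝ) × ℝ) × ℝ =>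
      f z.1.1 z.1.2 z.2) → ∫⁻ x, ∫⁻ a, ∫⁻ b, f x a b ∂ν ∂ν = ∫⁻ a, ∫⁻ b, ∫⁻ x, f x a b ∂volume ∂ν ∂ν := by
    intro f hf
    rw [lintegral_lintegral_swap (f := fun x a => ∫⁻ b, f x a b ∂ν)
      (Measurable.lintegral_prod_right' (f := fun z : ((ℝ × ℝ) × ℝ) × ℝ =>
        f z.1.1 z.1.2 z.2) hf).aemeasurable]
    refine lintegral_congr fun a => ?_
    rw [lintegral_lintegral_swap]
    exact (hf.comp (f := fun z : (ℝ × ℝ) × ℝ => ((z.1, a), z.2)) (by fun_prop)).aemeasurable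
  calc _ ≤ ∫⁻ x, ∫⁻ a, ∫⁻ b, 48 * (g (x - Γ a) * g (x - Γ b) * ‖a - b‖ₑ) ∂ν ∂ν := by
        gcongr with x a b
        exact h1 x a b
    _ = 48 * ∫⁻ x, ∫⁻ a, ∫⁻ b, g (x - Γ a) * g (x - Γ b) * ‖a - b‖ₑ ∂ν ∂ν := by
        simp_rw [lintegral_const_mul' _ _ (show (48 : ℝ≥0∞) ≠ ⊤ by norm_num)]
    _ = 48 * ∫⁻ a, ∫⁻ b, ∫⁻ x, g (x - Γ a) * g (x - Γ b) * ‖a - b‖ₑ ∂volume ∂ν ∂ν := by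
        rw [hswap _ hm]
    _ = 48 * ∫⁻ a, ∫⁻ b, ∫⁻ y, g y * (g (y + (Γ a - Γ b)) * ‖a - b‖ₑ) ∂volume ∂ν ∂ν := by
        congr 1
        refine lintegral_congr fun a => lintegral_congr fun b => ?_
        -- With x = y + Γa one factor no longer depends on a, b, and the other sees only the
        -- difference Γa - Γb.
        rw [← lintegral_add_right_eq_self _ (Γ a)]
        refine lintegral_congr fun y => ?_
        rw [add_sub_cancel_right, mul_assoc, add_sub_assoc]
    _ = 48 * ∫⁻ y, ∫⁻ a, ∫⁻ b, g y * (g (y + (Γ a - Γ b)) * ‖a - b‖ₑ) ∂ν ∂ν := by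
        rw [hswap (fun y a b => g y * (g (y + (Γ a - Γ b)) * ‖a - b‖ₑ)) hm2]
    _ ≤ 48 * ∫⁻ y, g y * (A * ∫⁻ x, g x) := by
        gcongr with y
        have : ∀ a, ∫⁻ b, g y * (g (y + (Γ a - Γ b)) * ‖a - b‖ₑ) ∂ν =
            g y * ∫⁻ b, (g (y + (Γ a - Γ b)) * ‖a - b‖ₑ) ∂ν := fun a =>
          lintegral_const_mul _ (by fun_prop)
        simp_rw [this]
        rw [lintegral_const_mul]
        · gcongr
          have := hA (fun x => g (y + x)) (by fun_prop)
          rwa [lintegral_add_left_eq_self g y] at this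
        · exact Measurable.lintegral_prod_right' (f := fun z : ℝ × ℝ =>
            g (y + (Γ z.1 - Γ z.2)) * ‖z.1 - z.2‖ₑ) (by fun_prop)
    _ = 48 * A * (∫⁻ x, g x) ^ 2 := by
        rw [lintegral_mul_const _ hg]
        ring

theorem ae_pairwise_ne (ν : Measure ℝ) [SFinite ν] [NullSingletonClass ν] (μ : Measure (ℝ × ℝ)) [SFinite μ] :
    ∀ᵐ z ∂(μ.prod (ν.prod (ν.prod ν))),
      z.2.1 ≠ z.2.2.1 ∧ z.2.1 ≠ z.2.2.2 ∧ z.2.2.1 ≠ z.2.2.2 := by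
  have hne : ∀ a : ℝ, ∀ᵐ t ∂ν, a ≠ t := fun a => by
    simp [ae_iff]
  have hdiag : ∀ᵐ z : ℝ × ℝ ∂(ν.prod ν), z.1 ≠ z.2 := by
    rw [Measure.ae_prod_iff_ae_ae (p := fun z : ℝ × ℝ => z.1 ≠ z.2)
      (measurableSet_eq_fun measurable_fst measurable_snd).compl]
    exact ae_of_all _ hne
  have h3 : ∀ᵐ z : ℝ × ℝ × ℝ ∂(ν.prod (ν.prod ν)),
      z.1 ≠ z.2.1 ∧ z.1 ≠ z.2.2 ∧ z.2.1 ≠ z.2.2 := by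
    rw [Measure.ae_prod_iff_ae_ae]
    · refine ae_of_all _ fun a => ?_
      have e1 := Measure.quasiMeasurePreserving_fst (μ := ν) (ν := ν) |>.ae (hne a)
      have e2 := Measure.quasiMeasurePreserving_snd (μ := ν) (ν := ν) |>.ae (hne a)
      filter_upwards [e1, e2, hdiag] with z h1 h2 h3 using ⟨h1, h2, h3⟩
    · exact ((measurableSet_eq_fun (by fun_prop) (by fun_prop)).compl).inter
        (((measurableSet_eq_fun (by fun_prop) (by fun_prop)).compl).inter
        ((measurableSet_eq_fun (by fun_prop) (by fun_prop)).compl))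
  exact Measure.quasiMeasurePreserving_snd (μ := μ) (ν := ν.prod (ν.prod ν)) |>.ae h3

/-- The strong type `(3/2, 3)` bound for averages over curves. -/
theorem lintegral_translateAverage_pow_three_le {ν : Measure ℝ} [SFinite ν] (hν : ν ≤ volume)
    {Γ : ℝ → ℝ × ℝ} (hΓ : Measurable Γ) {A : ℝ≥0∞}
    (hA : ∀ G : ℝ × ℝ → ℝ≥0∞, Measurable G →
      ∫⁻ s, ∫⁻ t, G (Γ s - Γ t) * ‖s - t‖ₑ ∂ν ∂ν ≤ A * ∫⁻ x, G x)
    {F : ℝ × ℝ → ℝ≥0∞} (hF : Measurable F) :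
    ∫⁻ x, translateAverage ν Γ F x ^ 3 ≤ 48 * A * (∫⁻ x, F x ^ (3 / 2 : ℝ)) ^ 2 := by
  have : NullSingletonClass ν := ⟨fun x => le_antisymm ((hν {x}).trans (by simp)) zero_le⟩
  set g : ℝ × ℝ → ℝ≥0∞ := fun x => F x ^ (3 / 2 : ℝ) with hgdef
  have hg : Measurable g := by simp only [hgdef]; fun_prop
  set M : Measure ((ℝ × ℝ) × ℝ × ℝ × ℝ) := volume.prod (ν.prod (ν.prod ν)) with hM
  set B : (ℝ × ℝ) → ℝ → ℝ → ℝ → ℝ≥0∞ := fun x a b s =>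
    g (x - Γ a) * g (x - Γ b) * tripleWeight a b s with hB
  have hBm : Measurable fun z : (ℝ × ℝ) × ℝ × ℝ × ℝ => B z.1 z.2.1 z.2.2.1 z.2.2.2 := by
    simp only [hB]
    fun_prop
  have hbil : ∫⁻ x, ∫⁻ a, ∫⁻ b, ∫⁻ s, B x a b s ∂ν ∂ν ∂ν ≤ 48 * A * (∫⁻ x, g x) ^ 2 :=
    lintegral_tripleWeight_bilinear_le hν hΓ hA hg
  have hsplit : ∀ f : (ℝ × ℝ) × ℝ × ℝ × ℝ → ℝ≥0∞, Measurable f →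
      ∫⁻ z, f z ∂M = ∫⁻ x, ∫⁻ a, ∫⁻ b, ∫⁻ s, f (x, a, b, s) ∂ν ∂ν ∂ν := by
    intro f hf
    rw [hM, lintegral_prod _ hf.aemeasurable]
    refine lintegral_congr fun x => ?_
    rw [lintegral_prod _ (by fun_prop)]
    refine lintegral_congr fun a => ?_
    rw [lintegral_prod _ (by fun_prop)]
  have hI3 : ∫⁻ z, B z.1 z.2.1 z.2.2.1 z.2.2.2 ∂M ≤ 48 * A * (∫⁻ x, g x) ^ 2 := by
    rw [hsplit _ hBm]
    exact hbil
  have hI2 : ∫⁻ z, B z.1 z.2.1 z.2.2.2 z.2.2.1 ∂M ≤ 48 * A * (∫⁻ x, g x) ^ 2 := by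
    rw [hsplit (fun z => B z.1 z.2.1 z.2.2.2 z.2.2.1) (hBm.comp
      (f := fun z : (ℝ × ℝ) × ℝ × ℝ × ℝ => (z.1, z.2.1, z.2.2.2, z.2.2.1)) (by fun_prop))]
    refine le_of_eq_of_le ?_ hbil
    refine lintegral_congr fun x => lintegral_congr fun a => ?_
    exact lintegral_lintegral_swap (hBm.comp
      (f := fun z : ℝ × ℝ => (x, a, z.2, z.1)) (by fun_prop)).aemeasurable
  have hI1 : ∫⁻ z, B z.1 z.2.2.1 z.2.2.2 z.2.1 ∂M ≤ 48 * A * (∫⁻ x, g x) ^ 2 := by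
    rw [hsplit (fun z => B z.1 z.2.2.1 z.2.2.2 z.2.1) (hBm.comp
      (f := fun z : (ℝ × ℝ) × ℝ × ℝ × ℝ => (z.1, z.2.2.1, z.2.2.2, z.2.1)) (by fun_prop))]
    refine le_of_eq_of_le ?_ hbil
    refine lintegral_congr fun x => ?_
    rw [lintegral_lintegral_swap]
    · refine lintegral_congr fun b => ?_
      exact lintegral_lintegral_swap (hBm.comp
        (f := fun z : ℝ × ℝ => (x, b, z.2, z.1)) (by fun_prop)).aemeasurable
    · exact (Measurable.lintegral_prod_right' (ν := ν)
        (f := fun z : (ℝ × ℝ) × ℝ => B x z.1.2 z.2 z.1.1)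
        (hBm.comp (f := fun z : (ℝ × ℝ) × ℝ => (x, z.1.2, z.2, z.1.1))
          (by fun_prop))).aemeasurable
  have hpow : ∫⁻ x, translateAverage ν Γ F x ^ 3 =
      ∫⁻ z, F (z.1 - Γ z.2.1) * (F (z.1 - Γ z.2.2.1) * F (z.1 - Γ z.2.2.2)) ∂M := by
    rw [hsplit _ (by fun_prop)]
    refine lintegral_congr fun x => ?_
    have e1 : ∀ a b, ∫⁻ s, F (x - Γ a) * (F (x - Γ b) * F (x - Γ s)) ∂ν =
        F (x - Γ a) * (F (x - Γ b) * translateAverage ν Γ F x) := by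
      intro a b
      rw [lintegral_const_mul _ (by fun_prop), lintegral_const_mul _ (by fun_prop)]
      rfl
    simp_rw [e1]
    have e2 : ∀ a, ∫⁻ b, F (x - Γ a) * (F (x - Γ b) * translateAverage ν Γ F x) ∂ν =
        F (x - Γ a) * (translateAverage ν Γ F x * translateAverage ν Γ F x) := by
      intro a
      rw [lintegral_const_mul _ (by fun_prop), lintegral_mul_const _ (by fun_prop)]
      rfl
    simp_rw [e2]
    rw [lintegral_mul_const _ (by fun_prop), pow_three]
    rfl
  -- In the product of the three terms each g occurs twice and the weights cancel; the cube root
  -- leaves g^(2/3) = F at each point. The diagonals, where the weights fail to cancel, are null.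
  have hpt : ∀ᵐ z ∂M, F (z.1 - Γ z.2.1) * (F (z.1 - Γ z.2.2.1) * F (z.1 - Γ z.2.2.2)) =
      ∏ i : Fin 3, (![fun z : (ℝ × ℝ) × ℝ × ℝ × ℝ => B z.1 z.2.1 z.2.2.1 z.2.2.2,
        fun z => B z.1 z.2.1 z.2.2.2 z.2.2.1, fun z => B z.1 z.2.2.1 z.2.2.2 z.2.1] i z) ^
          (1 / 3 : ℝ) := by
    filter_upwards [ae_pairwise_ne ν volume] with z hz
    rw [Fin.prod_univ_three]
    simp only [Matrix.cons_val_zero, Matrix.cons_val_one, Matrix.cons_val_two, Matrix.head_cons,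
      Matrix.tail_cons, hB]
    rw [← ENNReal.mul_rpow_of_nonneg _ _ (by norm_num), ← ENNReal.mul_rpow_of_nonneg _ _ (by norm_num)]
    set y₁ := z.1 - Γ z.2.1
    set y₂ := z.1 - Γ z.2.2.1
    set y₃ := z.1 - Γ z.2.2.2
    have e : g y₁ * g y₂ * tripleWeight z.2.1 z.2.2.1 z.2.2.2 *
        (g y₁ * g y₃ * tripleWeight z.2.1 z.2.2.2 z.2.2.1) *
        (g y₂ * g y₃ * tripleWeight z.2.2.1 z.2.2.2 z.2.1) =
        (g y₁ * (g y₂ * g y₃)) ^ (2 : ℝ) := by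
      rw [show (2 : ℝ) = (2 : ℕ) by norm_num, ENNReal.rpow_natCast, ← mul_one ((_ : ℝ≥0∞) ^ 2),
        ← tripleWeight_mul_eq_one hz.1 hz.2.1 hz.2.2]
      ring
    rw [e, ← ENNReal.rpow_mul]
    simp only [hgdef]
    rw [← ENNReal.mul_rpow_of_nonneg _ _ (by norm_num),
      ← ENNReal.mul_rpow_of_nonneg _ _ (by norm_num), ← ENNReal.rpow_mul]
    norm_num
  rw [hpow, lintegral_congr_ae hpt]
  refine (ENNReal.lintegral_prod_norm_pow_le (μ := M) (Finset.univ : Finset (Fin 3))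
    (fun i _ => ?_) (by norm_num [Fin.sum_univ_three]) (fun i _ => by norm_num)).trans ?_
  · fin_cases i
    · exact hBm.aemeasurable
    · exact (hBm.comp (f := fun z : (ℝ × ℝ) × ℝ × ℝ × ℝ => (z.1, z.2.1, z.2.2.2, z.2.2.1))
        (by fun_prop)).aemeasurable
    · exact (hBm.comp (f := fun z : (ℝ × ℝ) × ℝ × ℝ × ℝ => (z.1, z.2.2.1, z.2.2.2, z.2.1))
        (by fun_prop)).aemeasurable
  · rw [Fin.prod_univ_three]
    set C := 48 * A * (∫⁻ x, g x) ^ 2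
    calc _ ≤ C ^ (1 / 3 : ℝ) * C ^ (1 / 3 : ℝ) * C ^ (1 / 3 : ℝ) := by
          gcongr
          · exact hI3
          · exact hI2
          · exact hI1
      _ = C := by
          rw [← ENNReal.rpow_add_of_nonneg _ _ (by norm_num) (by norm_num),
            ← ENNReal.rpow_add_of_nonneg _ _ (by norm_num) (by norm_num)]
          norm_num

/-! ### Interpolation and summation over dyadic pieces. -/

theorem ENNReal.lintegral_three_mul_rpow_le {α : Type*} [MeasurableSpace α] {μ : Measure α}
    {f g h : α → ℝ≥0∞} (hf : AEMeasurable f μ) (hg : AEMeasurable g μ) (hh : AEMeasurable h μ)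
    {a b c : ℝ} (ha : 0 ≤ a) (hb : 0 ≤ b) (hc : 0 ≤ c) (habc : a + b + c = 1) :
    ∫⁻ x, f x ^ a * g x ^ b * h x ^ c ∂μ ≤
      (∫⁻ x, f x ∂μ) ^ a * (∫⁻ x, g x ∂μ) ^ b * (∫⁻ x, h x ∂μ) ^ c := by
  have := ENNReal.lintegral_prod_norm_pow_le (μ := μ) (Finset.univ : Finset (Fin 3))
    (f := ![f, g, h]) (p := ![a, b, c]) (fun i _ => by fin_cases i <;> assumption)
    (by simpa [Fin.sum_univ_three] using habc) (fun i _ => by fin_cases i <;> assumption)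
  simpa [Fin.prod_univ_three] using this

/-- Interpolation between the trivial `L¹` and `L^∞` bounds and the `(3/2, 3)` bound. -/
theorem lintegral_translateAverage_rpow_le {ν : Measure ℝ} [SFinite ν] (hν : ν ≤ volume)
    {Γ : ℝ → ℝ × ℝ} (hΓ : Measurable Γ) {A : ℝ≥0∞}
    (hA : ∀ G : ℝ × ℝ → ℝ≥0∞, Measurable G →
      ∫⁻ s, ∫⁻ t, G (Γ s - Γ t) * ‖s - t‖ₑ ∂ν ∂ν ≤ A * ∫⁻ x, G x)
    {F : ℝ × ℝ → ℝ≥0∞} (hF : Measurable F) {p q : ℝ} (hp : 1 ≤ p) (hq : 0 < q)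
    (h₁ : p⁻¹ / 2 ≤ q⁻¹) (h₂ : q⁻¹ ≤ p⁻¹) (h₃ : 2 * p⁻¹ - 1 ≤ q⁻¹) :
    (∫⁻ x, translateAverage ν Γ F x ^ q) ^ q⁻¹ ≤
      ν univ ^ (1 - 3 * (p⁻¹ - q⁻¹)) * (48 * A) ^ (p⁻¹ - q⁻¹) * (∫⁻ x, F x ^ p) ^ p⁻¹ := by
  set δ := p⁻¹ - q⁻¹ with hδ
  have hp0 : 0 < p := by linarith
  have hδ0 : 0 ≤ δ := by linarith
  -- Barycentric coordinates of (1/p, 1/q): θ₀ at (0,0), θ₁ at (1,1), 3δ at (2/3,1/3). Their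
  -- nonnegativity is exactly membership in the triangle.
  set θ₁ := q⁻¹ - δ with hθ₁
  set θ₀ := 1 - θ₁ - 3 * δ with hθ₀
  have hθ₁0 : 0 ≤ θ₁ := by linarith
  have hθ₀0 : 0 ≤ θ₀ := by linarith
  set J := ∫⁻ x, F x ^ p
  have hqi : q⁻¹ * q = 1 := inv_mul_cancel₀ hq.ne'
  have hpi : p⁻¹ * p = 1 := inv_mul_cancel₀ hp0.ne'
  -- Hölder in t applied to F = 1^θ₀ · (F^p)^θ₁ · (F^(2p/3))^(3δ). The power 2p/3 is the one whose
  -- L^(3/2) norm is governed by the integral of F^p.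
  have hpt : ∀ x, translateAverage ν Γ F x ≤ ν univ ^ θ₀ *
      (translateAverage ν Γ (fun x => F x ^ p) x ^ θ₁ *
        translateAverage ν Γ (fun x => F x ^ (2 * p / 3)) x ^ (3 * δ)) := by
    intro x
    have hH := ENNReal.lintegral_three_mul_rpow_le (μ := ν) (f := fun _ => 1)
      (g := fun t => F (x - Γ t) ^ p) (h := fun t => F (x - Γ t) ^ (2 * p / 3))
      (by fun_prop) (by fun_prop) (by fun_prop) hθ₀0 hθ₁0 (by linarith : 0 ≤ 3 * δ)
      (by rw [hθ₀]; ring)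
    simp only [ENNReal.one_rpow, one_mul, lintegral_one, ← ENNReal.rpow_mul] at hH
    have : ∀ y : ℝ≥0∞, y ^ (p * θ₁) * y ^ (2 * p / 3 * (3 * δ)) = y := by
      intro y
      rw [← ENNReal.rpow_add_of_nonneg _ _ (by positivity) (by positivity)]
      have : p * θ₁ + 2 * p / 3 * (3 * δ) = 1 := by
        rw [hθ₁, hδ]
        linear_combination hpi
      rw [this, ENNReal.rpow_one]
    simp only [this] at hH
    rw [mul_assoc] at hH
    exact hH
  have hS1m := measurable_translateAverage (ν := ν) hΓ (F := fun x => F x ^ p) (by fun_prop)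
  have hS2m := measurable_translateAverage (ν := ν) hΓ (F := fun x => F x ^ (2 * p / 3))
    (by fun_prop)
  have hS1 : ∫⁻ x, translateAverage ν Γ (fun x => F x ^ p) x = ν univ * J :=
    lintegral_translateAverage hΓ (by fun_prop)
  have hS2 : ∫⁻ x, translateAverage ν Γ (fun x => F x ^ (2 * p / 3)) x ^ 3 ≤ 48 * A * J ^ 2 := by
    have := lintegral_translateAverage_pow_three_le hν hΓ hA (F := fun x => F x ^ (2 * p / 3))
      (by fun_prop)
    simp only [← ENNReal.rpow_mul] at this
    rwa [show 2 * p / 3 * (3 / 2) = p by ring] at this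
  have hint : ∫⁻ x, translateAverage ν Γ F x ^ q ≤
      (ν univ ^ θ₀) ^ q * ((ν univ * J) ^ (θ₁ * q) * (48 * A * J ^ 2) ^ (δ * q)) := by
    calc ∫⁻ x, translateAverage ν Γ F x ^ q
        ≤ ∫⁻ x, (ν univ ^ θ₀) ^ q * ((1 : ℝ≥0∞) ^ (0 : ℝ) *
            translateAverage ν Γ (fun x => F x ^ p) x ^ (θ₁ * q) *
            (translateAverage ν Γ (fun x => F x ^ (2 * p / 3)) x ^ 3) ^ (δ * q)) := by
          refine lintegral_mono fun x => ?_
          refine (ENNReal.rpow_le_rpow (hpt x) hq.le).trans (le_of_eq ?_)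
          rw [ENNReal.mul_rpow_of_nonneg _ _ hq.le, ENNReal.mul_rpow_of_nonneg _ _ hq.le,
            ← ENNReal.rpow_mul _ θ₁, ← ENNReal.rpow_mul _ (3 * δ), ← ENNReal.rpow_natCast,
            ← ENNReal.rpow_mul _ ((3 : ℕ) : ℝ), ENNReal.one_rpow, one_mul]
          congr 3
          push_cast
          ring
      _ ≤ (ν univ ^ θ₀) ^ q * ((ν univ * J) ^ (θ₁ * q) * (48 * A * J ^ 2) ^ (δ * q)) := by
          rw [lintegral_const_mul _ (by fun_prop)]
          refine mul_le_mul_right ?_ _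
          refine (ENNReal.lintegral_three_mul_rpow_le (f := fun _ => (1 : ℝ≥0∞)) (by fun_prop)
            (by fun_prop) (by fun_prop) le_rfl (by positivity) (by positivity) ?_).trans ?_
          · rw [hθ₁]
            linear_combination hqi
          · rw [ENNReal.rpow_zero, one_mul, hS1]
            gcongr
  refine (ENNReal.rpow_le_rpow hint (by positivity)).trans (le_of_eq ?_)
  have hqq : q * q⁻¹ = 1 := mul_inv_cancel₀ hq.ne'
  rw [ENNReal.mul_rpow_of_nonneg _ _ (by positivity), ENNReal.mul_rpow_of_nonneg _ _ (by positivity),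
    ← ENNReal.rpow_mul, ← ENNReal.rpow_mul, ← ENNReal.rpow_mul, ← ENNReal.rpow_mul,
    mul_assoc θ₁, mul_assoc δ, hqq, mul_one, mul_one, mul_one,
    ENNReal.mul_rpow_of_nonneg _ _ hθ₁0, ENNReal.mul_rpow_of_nonneg _ _ hδ0,
    ← ENNReal.rpow_natCast, ← ENNReal.rpow_mul]
  calc _ = (ν univ ^ θ₀ * ν univ ^ θ₁) * (48 * A) ^ δ * (J ^ θ₁ * J ^ (((2 : ℕ) : ℝ) * δ)) := by
        ring
    _ = _ := by
        rw [← ENNReal.rpow_add_of_nonneg _ _ hθ₀0 hθ₁0,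
          ← ENNReal.rpow_add_of_nonneg _ _ hθ₁0 (by positivity)]
        congr 3
        · rw [hθ₀]; ring
        · rw [hθ₁, hδ]; push_cast; ring

theorem lintegral_finset_sum_rpow_le {α : Type*} [MeasurableSpace α] {μ : Measure α}
    {f : ℕ → α → ℝ≥0∞} (hf : ∀ n, Measurable (f n)) {q : ℝ} (hq : 1 ≤ q) (n : ℕ) :
    (∫⁻ x, (∑ i ∈ Finset.range n, f i x) ^ q ∂μ) ^ q⁻¹ ≤
      ∑ i ∈ Finset.range n, (∫⁻ x, f i x ^ q ∂μ) ^ q⁻¹ := by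
  have hq0 : 0 < q := by linarith
  induction n with
  | zero => simp [hq0]
  | succ n ih =>
    simp_rw [Finset.sum_range_succ]
    have := ENNReal.lintegral_Lp_add_le (μ := μ) (f := fun x => ∑ i ∈ Finset.range n, f i x)
      (g := f n) (by fun_prop) (by fun_prop) hq
    simp only [Pi.add_apply, one_div] at this
    exact this.trans (by gcongr)

/-- Minkowski's inequality for countable sums of nonnegative functions. -/
theorem lintegral_tsum_rpow_le {α : Type*} [MeasurableSpace α] {μ : Measure α}
    {f : ℕ → α → ℝ≥0∞} (hf : ∀ n, Measurable (f n)) {q : ℝ} (hq : 1 ≤ q) :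
    (∫⁻ x, (∑' i, f i x) ^ q ∂μ) ^ q⁻¹ ≤ ∑' i, (∫⁻ x, f i x ^ q ∂μ) ^ q⁻¹ := by
  have hq0 : 0 < q := by linarith
  have hlim : Tendsto (fun n => ∫⁻ x, (∑ i ∈ Finset.range n, f i x) ^ q ∂μ) atTop
      (𝓝 (∫⁻ x, (∑' i, f i x) ^ q ∂μ)) := by
    refine lintegral_tendsto_of_tendsto_of_monotone (fun n => by fun_prop) ?_ ?_
    · refine ae_of_all _ fun x n m hnm => ?_
      exact ENNReal.rpow_le_rpow (Finset.sum_le_sum_of_subset (Finset.range_mono hnm)) hq0.le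
    · refine ae_of_all _ fun x => ?_
      exact (ENNReal.continuous_rpow_const.tendsto _).comp ENNReal.summable.hasSum.tendsto_sum_nat
  refine le_of_tendsto' ((ENNReal.continuous_rpow_const.tendsto _).comp hlim) fun n => ?_
  exact (lintegral_finset_sum_rpow_le hf hq n).trans (ENNReal.sum_le_tsum _)

theorem Ioc_zero_one_subset_iUnion_dyadic :
    Ioc (0 : ℝ) 1 ⊆ ⋃ k : ℕ, Ioc ((1 / 2 : ℝ) ^ (k + 1)) ((1 / 2) ^ k) := by
  intro t ht
  obtain ⟨n, h1, h2⟩ := exists_nat_pow_near_of_lt_one ht.1 ht.2 (by norm_num : (0 : ℝ) < 1 / 2)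
    (by norm_num)
  exact mem_iUnion.2 ⟨n, h1, h2⟩

/-- The averaging operator over `(0, 1]` is bounded if its curvature does not vanish faster than
a suitable power at the origin. -/
theorem lintegral_curve_average_le {γ γ' : ℝ → ℝ} (hγ : Measurable γ)
    (hd : ∀ t ∈ Ioc (0 : ℝ) 1, HasDerivWithinAt γ (γ' t) (Ioc 0 1) t)
    {c σ : ℝ} (hc : 0 < c)
    (hcurv : ∀ k : ℕ, ∀ s ∈ Ioc ((1 / 2 : ℝ) ^ (k + 1)) ((1 / 2) ^ k),
      ∀ t ∈ Ioc ((1 / 2 : ℝ) ^ (k + 1)) ((1 / 2) ^ k),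
        c * ((1 / 2 : ℝ) ^ k) ^ σ * |s - t| ≤ |γ' s - γ' t|)
    {p q : ℝ} (hp : 1 ≤ p) (hq : 0 < q)
    (h₁ : p⁻¹ / 2 ≤ q⁻¹) (h₂ : q⁻¹ ≤ p⁻¹) (h₃ : 2 * p⁻¹ - 1 ≤ q⁻¹)
    (hσ : 0 < 1 - 3 * (p⁻¹ - q⁻¹) - σ * (p⁻¹ - q⁻¹)) :
    ∃ C : ℝ≥0∞, C ≠ ⊤ ∧ ∀ u : ℝ, 1 ≤ u → ∀ F : ℝ × ℝ → ℝ≥0∞, Measurable F →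
      (∫⁻ x, translateAverage (volume.restrict (Ioc 0 1)) (fun t => (u * t, u * γ t)) F x ^ q) ^ q⁻¹
        ≤ C * (∫⁻ x, F x ^ p) ^ p⁻¹ := by
  set δ := p⁻¹ - q⁻¹ with hδ
  have hδ0 : 0 ≤ δ := by linarith
  -- Minkowski's inequality over the pieces needs q ≥ 1; here 1/q ≤ 1/p ≤ 1.
  have hq1 : 1 ≤ q := by
    have hpi : p⁻¹ ≤ 1 := inv_le_one_of_one_le₀ hp
    have := one_le_inv_iff₀.2 ⟨inv_pos.2 hq, h₂.trans hpi⟩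
    rwa [inv_inv] at this
  set η := 1 - 3 * δ - σ * δ with hη
  have hexp0 : 0 ≤ 1 - 3 * δ := by
    have : (0 : ℝ) < q⁻¹ := inv_pos.2 hq
    linarith
  set I : ℕ → Set ℝ := fun k => Ioc ((1 / 2 : ℝ) ^ (k + 1)) ((1 / 2) ^ k) with hI
  have hIsub : ∀ k, I k ⊆ Ioc 0 1 := fun k t ht =>
    ⟨lt_trans (by positivity) ht.1, ht.2.trans (pow_le_one₀ (by norm_num) (by norm_num))⟩
  set b : ℕ → ℝ≥0∞ := fun k => volume (I k) ^ (1 - 3 * δ) *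
    (48 * ENNReal.ofReal (c * ((1 / 2 : ℝ) ^ k) ^ σ)⁻¹) ^ δ with hb
  -- With r = 2^(-k), length contributes r^(1-3δ) and inverse curvature r^(-σδ), together r^η with η
  -- > 0.
  have hbval : ∀ k, b k ≤ ENNReal.ofReal ((48 * c⁻¹) ^ δ * (((1 / 2 : ℝ) ^ η) ^ k)) := by
    intro k
    have hr : (0 : ℝ) < (1 / 2) ^ k := by positivity
    have hvol : volume (I k) ≤ ENNReal.ofReal ((1 / 2 : ℝ) ^ k) := by
      rw [hI, Real.volume_Ioc]
      apply ENNReal.ofReal_le_ofReal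
      have : (0 : ℝ) < (1 / 2) ^ (k + 1) := by positivity
      linarith
    calc b k ≤ ENNReal.ofReal ((1 / 2 : ℝ) ^ k) ^ (1 - 3 * δ) *
          (48 * ENNReal.ofReal (c * ((1 / 2 : ℝ) ^ k) ^ σ)⁻¹) ^ δ := by
          simp only [hb]
          gcongr
      _ = ENNReal.ofReal ((48 * c⁻¹) ^ δ * (((1 / 2 : ℝ) ^ η) ^ k)) := by
          rw [show (48 : ℝ≥0∞) = ENNReal.ofReal 48 by norm_num, ← ENNReal.ofReal_mul (by norm_num),
            ENNReal.ofReal_rpow_of_nonneg hr.le hexp0,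
            ENNReal.ofReal_rpow_of_nonneg (by positivity) hδ0, ← ENNReal.ofReal_mul (by positivity)]
          congr 1
          rw [mul_inv, ← mul_assoc, Real.mul_rpow (by positivity) (by positivity),
            ← Real.rpow_neg hr.le, ← Real.rpow_mul hr.le, ← Real.rpow_natCast (_ ^ η),
            ← Real.rpow_mul (by norm_num), mul_comm η,
            Real.rpow_mul (by norm_num : (0 : ℝ) ≤ 1 / 2) k η,
            Real.rpow_natCast, mul_left_comm, ← Real.rpow_add hr]
          congr 2
          rw [hη]
          ring
  have hbsum : ∑' k, b k ≠ ⊤ := by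
    refine ne_top_of_le_ne_top ?_ (ENNReal.tsum_le_tsum hbval)
    refine Summable.tsum_ofReal_ne_top ?_
    refine (summable_geometric_of_lt_one (by positivity) ?_).mul_left _
    exact Real.rpow_lt_one (by norm_num) (by norm_num) hσ
  refine ⟨∑' k, b k, hbsum, fun u hu F hF => ?_⟩
  set Γ : ℝ → ℝ × ℝ := fun t => (u * t, u * γ t) with hΓdef
  have hΓ : Measurable Γ := by simp only [hΓdef]; fun_prop
  have hle : ∀ x, translateAverage (volume.restrict (Ioc 0 1)) Γ F x ≤
      ∑' k, translateAverage (volume.restrict (I k)) Γ F x := fun x =>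
    (lintegral_mono_set Ioc_zero_one_subset_iUnion_dyadic).trans (lintegral_iUnion_le _ _)
  calc _ ≤ (∫⁻ x, (∑' k, translateAverage (volume.restrict (I k)) Γ F x) ^ q) ^ q⁻¹ := by
        gcongr with x
        exact hle x
    _ ≤ ∑' k, (∫⁻ x, translateAverage (volume.restrict (I k)) Γ F x ^ q) ^ q⁻¹ :=
        lintegral_tsum_rpow_le (fun k => measurable_translateAverage hΓ hF) hq1
    _ ≤ ∑' k, b k * (∫⁻ x, F x ^ p) ^ p⁻¹ := by
        refine ENNReal.tsum_le_tsum fun k => ?_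
        have hA := fun (G : ℝ × ℝ → ℝ≥0∞) (hG : Measurable G) =>
          lintegral_difference_le hγ (I := I k) ordConnected_Ioc
            (fun t ht => (hd t (hIsub k ht)).mono (hIsub k))
            (κ := c * ((1 / 2 : ℝ) ^ k) ^ σ) (by positivity) (hcurv k) hu hG
        have := lintegral_translateAverage_rpow_le Measure.restrict_le_self hΓ hA hF hp hq h₁ h₂ h₃
        rwa [Measure.restrict_apply_univ] at this
    _ = (∑' k, b k) * (∫⁻ x, F x ^ p) ^ p⁻¹ := ENNReal.tsum_mul_right

/-! ### From nonnegative functions to complex functions in L^p. -/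

/-- A property that holds almost everywhere holds along almost every translate of a curve. -/
theorem ae_ae_translate {ν : Measure ℝ} [SFinite ν] {Γ : ℝ → ℝ × ℝ} (hΓ : Measurable Γ)
    {P : ℝ × ℝ → Prop} (hP : ∀ᵐ y, P y) : ∀ᵐ x : ℝ × ℝ, ∀ᵐ t ∂ν, P (x - Γ t) := by
  have hm : Measurable fun z : (ℝ × ℝ) × ℝ => z.1 - Γ z.2 := by fun_prop
  have hq : Measure.QuasiMeasurePreserving (fun z : (ℝ × ℝ) × ℝ => z.1 - Γ z.2)
      ((volume : Measure (ℝ × ℝ)).prod ν) volume := by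
    refine ⟨hm, Measure.AbsolutelyContinuous.mk fun s hs h0 => ?_⟩
    rw [Measure.map_apply hm hs, Measure.prod_apply_symm (hm hs)]
    refine lintegral_eq_zero_of_ae_eq_zero (ae_of_all _ fun t => ?_)
    change volume ((fun x => x - Γ t) ⁻¹' s) = 0
    simp only [sub_eq_add_neg]
    rw [measure_preimage_add_right, h0]
  exact Measure.ae_ae_of_ae_prod (hq.ae hP)

/-- The curve `t ↦ (u t, u γ(t))`, with `γ` replaced by zero outside `(0, 1]`. -/
noncomputable def truncatedCurve (γ : ℝ → ℝ) (u t : ℝ) : ℝ × ℝ :=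
  (u * t, u * (Ioc (0 : ℝ) 1).indicator γ t)

theorem measurable_truncatedCurve {γ : ℝ → ℝ} (hγ : Measurable ((Ioc (0 : ℝ) 1).indicator γ))
    (u : ℝ) : Measurable (truncatedCurve γ u) := by
  unfold truncatedCurve
  fun_prop

theorem alongCurve_eq_truncatedCurve (γ : ℝ → ℝ) (f : ℝ × ℝ → ℂ) (x : ℝ × ℝ) (u : ℝ) {t : ℝ}
    (ht : t ∈ Ioc (0 : ℝ) 1) : alongCurve γ f x u t = f (x - truncatedCurve γ u t) := by
  simp only [alongCurve, truncatedCurve, indicator_of_mem ht]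
  rfl

section Transfer

variable {γ : ℝ → ℝ} {f g : ℝ × ℝ → ℂ}

theorem ae_alongCurve_eq (hγ : Measurable ((Ioc (0 : ℝ) 1).indicator γ)) (u : ℝ)
    (hfg : f =ᵐ[volume] g) : ∀ᵐ x : ℝ × ℝ, ∀ᵐ t ∂volume.restrict (Ioc (0 : ℝ) 1),
      alongCurve γ f x u t = g (x - truncatedCurve γ u t) := by
  filter_upwards [ae_ae_translate (ν := volume.restrict (Ioc (0 : ℝ) 1))
    (measurable_truncatedCurve hγ u) hfg] with x hx
  filter_upwards [hx, ae_restrict_mem measurableSet_Ioc] with t ht htm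
  rw [alongCurve_eq_truncatedCurve γ f x u htm, ht]

theorem aestronglyMeasurable_curveAverage (hγ : Measurable ((Ioc (0 : ℝ) 1).indicator γ)) (u : ℝ)
    (hg : StronglyMeasurable g) (hfg : f =ᵐ[volume] g) :
    AEStronglyMeasurable (fun x => curveAverage γ f x u) volume := by
  have hΓ := measurable_truncatedCurve hγ u
  refine ⟨fun x => ∫ t in Ioc (0 : ℝ) 1, g (x - truncatedCurve γ u t), ?_, ?_⟩
  · exact StronglyMeasurable.integral_prod_right'
      (f := fun z : (ℝ × ℝ) × ℝ => g (z.1 - truncatedCurve γ u z.2))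
      (hg.comp_measurable (by fun_prop))
  · filter_upwards [ae_alongCurve_eq hγ u hfg] with x hx
    rw [curveAverage, intervalIntegral.integral_of_le zero_le_one]
    exact integral_congr_ae hx

theorem ae_enorm_curveAverage_le (hγ : Measurable ((Ioc (0 : ℝ) 1).indicator γ)) (u : ℝ)
    (hfg : f =ᵐ[volume] g) : ∀ᵐ x : ℝ × ℝ, ‖curveAverage γ f x u‖ₑ ≤
      translateAverage (volume.restrict (Ioc 0 1)) (truncatedCurve γ u) (fun y => ‖g y‖ₑ) x := by
  filter_upwards [ae_alongCurve_eq hγ u hfg] with x hx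
  rw [curveAverage, intervalIntegral.integral_of_le zero_le_one, integral_congr_ae hx]
  exact enorm_integral_le_lintegral_enorm _

theorem ae_intervalIntegrable_alongCurve (hγ : Measurable ((Ioc (0 : ℝ) 1).indicator γ)) (u : ℝ)
    (hg : StronglyMeasurable g) (hfg : f =ᵐ[volume] g)
    (hfin : ∀ᵐ x : ℝ × ℝ, translateAverage (volume.restrict (Ioc 0 1)) (truncatedCurve γ u)
      (fun y => ‖g y‖ₑ) x < ⊤) :
    ∀ᵐ x : ℝ × ℝ, IntervalIntegrable (fun t => alongCurve γ f x u t) volume 0 1 := by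
  have hΓ := measurable_truncatedCurve hγ u
  filter_upwards [ae_alongCurve_eq hγ u hfg, hfin] with x hx hlt
  rw [intervalIntegrable_iff_integrableOn_Ioc_of_le zero_le_one]
  refine Integrable.congr (f := fun t => g (x - truncatedCurve γ u t)) ⟨?_, hlt⟩ ?_
  · exact (hg.comp_measurable (by fun_prop)).aestronglyMeasurable
  · filter_upwards [hx] with t ht using ht.symm

end Transfer

/-- The vertex (0,0) is treated separately because the finite-exponent integral inequalities do not
cover it. The average is over a set of length 1, so the essential supremum does not increase. -/
theorem wellDefined_and_estimate_top {γ : ℝ → ℝ}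
    (hγ : Measurable ((Ioc (0 : ℝ) 1).indicator γ)) :
    WellDefinedOnLp γ ⊤ ∧ UniformLpLqEstimate γ ⊤ ⊤ := by
  have key : ∀ u : ℝ, ∀ f : ℝ × ℝ → ℂ, ∀ hf : MemLp f ⊤ volume, ∀ᵐ x : ℝ × ℝ,
      translateAverage (volume.restrict (Ioc 0 1)) (truncatedCurve γ u)
        (fun y => ‖hf.aestronglyMeasurable.mk f y‖ₑ) x ≤ eLpNorm f ⊤ volume := by
    intro u f hf
    have hb : ∀ᵐ y, ‖hf.aestronglyMeasurable.mk f y‖ₑ ≤ eLpNorm f ⊤ volume := by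
      rw [eLpNorm_exponent_top]
      filter_upwards [enorm_ae_le_eLpNormEssSup f volume, hf.aestronglyMeasurable.ae_eq_mk] with y hy h
      rwa [← h]
    filter_upwards [ae_ae_translate (ν := volume.restrict (Ioc (0 : ℝ) 1))
      (measurable_truncatedCurve hγ u) hb] with x hx
    refine (lintegral_mono_ae hx).trans ?_
    simp
  refine ⟨fun u _ f hf => ⟨?_, ?_⟩, 1, one_pos, fun u _ f hf => ?_⟩
  · refine ae_intervalIntegrable_alongCurve hγ u hf.aestronglyMeasurable.stronglyMeasurable_mk hf.aestronglyMeasurable.ae_eq_mk ?_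
    filter_upwards [key u f hf] with x hx using hx.trans_lt hf.2
  · exact aestronglyMeasurable_curveAverage hγ u hf.aestronglyMeasurable.stronglyMeasurable_mk hf.aestronglyMeasurable.ae_eq_mk
  · rw [ENNReal.ofReal_one, one_mul, eLpNorm_exponent_top (f := fun x => curveAverage γ f x u)]
    refine eLpNormEssSup_le_of_ae_enorm_bound ?_
    filter_upwards [key u f hf, ae_enorm_curveAverage_le hγ u hf.aestronglyMeasurable.ae_eq_mk] with x h1 h2
      using h2.trans h1

/-- The bound applied to the absolute value of a measurable representative makes its average an L^q
function, hence finite almost everywhere: this is absolute convergence. It also dominates the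
complex average. -/
theorem wellDefined_and_estimate_of_lintegral_le {γ : ℝ → ℝ}
    (hγ : Measurable ((Ioc (0 : ℝ) 1).indicator γ)) {p q : ℝ≥0∞} (hp0 : p ≠ 0) (hp : p ≠ ⊤)
    (hq0 : q ≠ 0) (hq : q ≠ ⊤) {C : ℝ≥0∞} (hC : C ≠ ⊤)
    (h : ∀ u : ℝ, 1 ≤ u → ∀ F : ℝ × ℝ → ℝ≥0∞, Measurable F →
      (∫⁻ x, translateAverage (volume.restrict (Ioc 0 1)) (truncatedCurve γ u) F x ^ q.toReal)
        ^ q.toReal⁻¹ ≤ C * (∫⁻ x, F x ^ p.toReal) ^ p.toReal⁻¹) :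
    WellDefinedOnLp γ p ∧ UniformLpLqEstimate γ p q := by
  have hq' : 0 < q.toReal := ENNReal.toReal_pos hq0 hq
  have key : ∀ u ∈ Icc (1 : ℝ) 2, ∀ f : ℝ × ℝ → ℂ, ∀ hf : MemLp f p volume,
      (∫⁻ x, translateAverage (volume.restrict (Ioc 0 1)) (truncatedCurve γ u)
        (fun y => ‖hf.aestronglyMeasurable.mk f y‖ₑ) x ^ q.toReal) ^ q.toReal⁻¹ ≤ C * eLpNorm f p volume := by
    intro u hu f hf
    refine (h u hu.1 (fun y => ‖hf.aestronglyMeasurable.mk f y‖ₑ) hf.aestronglyMeasurable.stronglyMeasurable_mk.enorm).trans ?_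
    rw [eLpNorm_congr_ae hf.aestronglyMeasurable.ae_eq_mk, eLpNorm_eq_lintegral_rpow_enorm_toReal hp0 hp, one_div]
  -- Adding 1 makes the constant positive even if C = 0.
  refine ⟨fun u hu f hf => ⟨?_, ?_⟩, C.toReal + 1, by positivity, fun u hu f hf => ?_⟩
  · refine ae_intervalIntegrable_alongCurve hγ u hf.aestronglyMeasurable.stronglyMeasurable_mk hf.aestronglyMeasurable.ae_eq_mk ?_
    have hlt := (key u hu f hf).trans_lt (ENNReal.mul_lt_top hC.lt_top hf.2)
    rw [ENNReal.rpow_lt_top_iff_of_pos (inv_pos.2 hq')] at hlt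
    have hm : Measurable (translateAverage (volume.restrict (Ioc 0 1)) (truncatedCurve γ u)
        (fun y => ‖hf.aestronglyMeasurable.mk f y‖ₑ)) := measurable_translateAverage
      (measurable_truncatedCurve hγ u) hf.aestronglyMeasurable.stronglyMeasurable_mk.enorm
    filter_upwards [ae_lt_top (hm.pow_const _) hlt.ne] with x hx
    rwa [ENNReal.rpow_lt_top_iff_of_pos hq'] at hx
  · exact aestronglyMeasurable_curveAverage hγ u hf.aestronglyMeasurable.stronglyMeasurable_mk hf.aestronglyMeasurable.ae_eq_mk
  · calc eLpNorm (fun x => curveAverage γ f x u) q volume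
        ≤ (∫⁻ x, translateAverage (volume.restrict (Ioc 0 1)) (truncatedCurve γ u)
          (fun y => ‖hf.aestronglyMeasurable.mk f y‖ₑ) x ^ q.toReal) ^ q.toReal⁻¹ := by
          rw [eLpNorm_eq_lintegral_rpow_enorm_toReal hq0 hq, one_div]
          refine ENNReal.rpow_le_rpow (lintegral_mono_ae ?_) (by positivity)
          filter_upwards [ae_enorm_curveAverage_le hγ u hf.aestronglyMeasurable.ae_eq_mk] with x hx
          gcongr
      _ ≤ C * eLpNorm f p volume := key u hu f hf
      _ ≤ ENNReal.ofReal (C.toReal + 1) * eLpNorm f p volume := by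
          gcongr
          rw [← ENNReal.ofReal_toReal hC, ENNReal.toReal_ofReal ENNReal.toReal_nonneg]
          exact ENNReal.ofReal_le_ofReal (by linarith)

/-! ### Size and curvature of γ near the origin. -/

section CurveRegularity

variable {γ : ℝ → ℝ}

theorem ne_zero_of_le_abs_mul_derivWithin_div
    (hlow : ∃ c : ℝ, 0 < c ∧ ∀ t ∈ Ioc (0 : ℝ) 1, c ≤ |t * derivWithin γ (Ioc 0 1) t / γ t|)
    {t : ℝ} (ht : t ∈ Ioc (0 : ℝ) 1) : γ t ≠ 0 := by
  obtain ⟨c, hc, h⟩ := hlow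
  intro h0
  have := h t ht
  rw [h0, div_zero, abs_zero] at this
  linarith

theorem uniqueDiffOn_Ioc_zero_one : UniqueDiffOn ℝ (Ioc (0 : ℝ) 1) := uniqueDiffOn_Ioc 0 1

theorem hasDerivWithinAt_of_contDiffOn_two (hγ : ContDiffOn ℝ 2 γ (Ioc 0 1)) {t : ℝ}
    (ht : t ∈ Ioc (0 : ℝ) 1) :
    HasDerivWithinAt γ (derivWithin γ (Ioc 0 1) t) (Ioc 0 1) t :=
  (hγ.differentiableOn (by norm_num) t ht).hasDerivWithinAt

theorem hasDerivWithinAt_derivWithin_of_contDiffOn_two (hγ : ContDiffOn ℝ 2 γ (Ioc 0 1)) {t : ℝ}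
    (ht : t ∈ Ioc (0 : ℝ) 1) :
    HasDerivWithinAt (derivWithin γ (Ioc 0 1)) (iteratedDerivWithin 2 γ (Ioc 0 1) t)
      (Ioc 0 1) t := by
  have h1 : ContDiffOn ℝ 1 (derivWithin γ (Ioc 0 1)) (Ioc 0 1) :=
    hγ.derivWithin uniqueDiffOn_Ioc_zero_one (by norm_num)
  have h2 := (h1.differentiableOn (by norm_num) t ht).hasDerivWithinAt
  have h3 : iteratedDerivWithin 2 γ (Ioc 0 1) t =
      derivWithin (derivWithin γ (Ioc 0 1)) (Ioc 0 1) t := by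
    rw [iteratedDerivWithin_succ, iteratedDerivWithin_one]
  rwa [h3]

/-- If the second derivative is at least `κ` in absolute value on an interval, the derivative
separates points. -/
theorem mul_abs_sub_le_abs_derivWithin_sub (hγ : ContDiffOn ℝ 2 γ (Ioc 0 1)) {I : Set ℝ}
    (hI : I.OrdConnected) (hsub : I ⊆ Ioc 0 1) {κ : ℝ}
    (hκ : ∀ t ∈ I, κ ≤ |iteratedDerivWithin 2 γ (Ioc 0 1) t|) :
    ∀ s ∈ I, ∀ t ∈ I,
      κ * |s - t| ≤ |derivWithin γ (Ioc 0 1) s - derivWithin γ (Ioc 0 1) t| := by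
  have aux : ∀ s ∈ I, ∀ t ∈ I, s < t →
      κ * |s - t| ≤ |derivWithin γ (Ioc 0 1) s - derivWithin γ (Ioc 0 1) t| := by
    intro s hs t ht hst
    have hIcc : Icc s t ⊆ I := hI.out hs ht
    have hcont : ContinuousOn (derivWithin γ (Ioc 0 1)) (Icc s t) := fun r hr =>
      ((hasDerivWithinAt_derivWithin_of_contDiffOn_two hγ
        (hsub (hIcc hr))).continuousWithinAt).mono (hIcc.trans hsub)
    obtain ⟨r, hr, hr'⟩ := exists_hasDerivAt_eq_slope _ _ hst hcont fun r hr =>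
      (hasDerivWithinAt_derivWithin_of_contDiffOn_two hγ
        (hsub (hIcc (Ioo_subset_Icc_self hr)))).hasDerivAt
          (mem_of_superset (Icc_mem_nhds hr.1 hr.2) (hIcc.trans hsub))
    have h1 := hκ r (hIcc (Ioo_subset_Icc_self hr))
    rw [hr', abs_div, le_div_iff₀ (abs_pos.2 (sub_ne_zero.2 hst.ne'))] at h1
    rw [abs_sub_comm s t, abs_sub_comm (derivWithin γ (Ioc 0 1) s)]
    exact h1
  intro s hs t ht
  rcases lt_trichotomy s t with h | h | h
  · exact aux s hs t ht h
  · simp [h]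
  · rw [abs_sub_comm s t, abs_sub_comm (derivWithin γ (Ioc 0 1) s)]
    exact aux t ht s hs h

/-- Since γ'/γ ≤ C/t, the function log|γ| - C log t is nonincreasing; compare t with 1. This makes
the quotient in `curveExponent` bounded above near 0, so its real-valued limsup carries information.
-/
theorem exists_rpow_le_abs (hγ : ContDiffOn ℝ 2 γ (Ioc 0 1))
    (hne : ∀ t ∈ Ioc (0 : ℝ) 1, γ t ≠ 0)
    (hup : ∃ c : ℝ, 0 < c ∧ ∀ t ∈ Ioc (0 : ℝ) 1, |t * derivWithin γ (Ioc 0 1) t / γ t| ≤ c) :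
    ∃ C : ℝ, 0 < C ∧ ∀ t ∈ Ioc (0 : ℝ) 1,
      Real.log |γ 1| + C * Real.log t ≤ Real.log |γ t| := by
  obtain ⟨C, hC, h⟩ := hup
  refine ⟨C, hC, fun t ht => ?_⟩
  have hcont : ContinuousOn (fun t => Real.log (γ t) - C * Real.log t) (Ioc 0 1) :=
    (hγ.continuousOn.log hne).sub
      (continuousOn_const.mul (continuousOn_id.log fun t ht => ht.1.ne'))
  have hder : ∀ t ∈ Ioo (0 : ℝ) 1, HasDerivAt (fun t => Real.log (γ t) - C * Real.log t)
      (derivWithin γ (Ioc 0 1) t / γ t - C * t⁻¹) t := by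
    intro t ht
    have ht' := Ioo_subset_Ioc_self ht
    have h1 := (hasDerivWithinAt_of_contDiffOn_two hγ ht').hasDerivAt
      (mem_of_superset (Ioo_mem_nhds ht.1 ht.2) Ioo_subset_Ioc_self)
    exact (h1.log (hne t ht')).sub ((Real.hasDerivAt_log ht.1.ne').const_mul C)
  have hanti : AntitoneOn (fun t => Real.log (γ t) - C * Real.log t) (Ioc 0 1) := by
    refine antitoneOn_of_deriv_nonpos (convex_Ioc 0 1) hcont ?_ ?_
    · rw [interior_Ioc]
      exact fun t ht => (hder t ht).differentiableAt.differentiableWithinAt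
    · rw [interior_Ioc]
      intro t ht
      rw [(hder t ht).deriv, sub_nonpos, ← div_eq_mul_inv, le_div_iff₀ ht.1]
      have := (le_abs_self _).trans (h t (Ioo_subset_Ioc_self ht))
      calc _ = t * derivWithin γ (Ioc 0 1) t / γ t := by ring
        _ ≤ C := this
  have := hanti ht ⟨zero_lt_one, le_rfl⟩ ht.2
  simp only [Real.log_one, mul_zero, sub_zero] at this
  rw [Real.log_abs, Real.log_abs]
  linarith

theorem isBoundedUnder_log_abs_div_log
    (h : ∃ C : ℝ, 0 < C ∧ ∀ t ∈ Ioc (0 : ℝ) 1,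
      Real.log |γ 1| + C * Real.log t ≤ Real.log |γ t|) :
    IsBoundedUnder (· ≤ ·) (𝓝[>] 0) fun t : ℝ => Real.log |γ t| / Real.log t := by
  obtain ⟨C, hC, h⟩ := h
  refine ⟨C + |Real.log (|γ 1|)|, ?_⟩
  rw [eventually_map]
  have hexp : Real.exp (-1) < 1 := by
    rw [Real.exp_lt_one_iff]
    norm_num
  filter_upwards [Ioo_mem_nhdsGT (Real.exp_pos (-1))] with t ht
  have hlog : Real.log t < -1 := by
    rw [Real.log_lt_iff_lt_exp ht.1]
    exact ht.2
  have h1 := h t ⟨ht.1, ht.2.le.trans hexp.le⟩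
  have h2 := neg_abs_le (Real.log (|γ 1|))
  have h3 := abs_nonneg (Real.log (|γ 1|))
  rw [div_le_iff_of_neg (by linarith)]
  nlinarith

/-- Near 0 the limsup gives log|γ| > α log t, the inequality turning because log t < 0. On the
remaining compact interval |γ|/t^α has a positive minimum. -/
theorem exists_mul_rpow_le_abs (hγ : ContDiffOn ℝ 2 γ (Ioc 0 1))
    (hne : ∀ t ∈ Ioc (0 : ℝ) 1, γ t ≠ 0)
    (hup : ∃ c : ℝ, 0 < c ∧ ∀ t ∈ Ioc (0 : ℝ) 1, |t * derivWithin γ (Ioc 0 1) t / γ t| ≤ c)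
    {α : ℝ} (hα : curveExponent γ < α) :
    ∃ c : ℝ, 0 < c ∧ ∀ t ∈ Ioc (0 : ℝ) 1, c * t ^ α ≤ |γ t| := by
  have hbdd := isBoundedUnder_log_abs_div_log (exists_rpow_le_abs hγ hne hup)
  have hev := eventually_lt_of_limsup_lt hα hbdd
  obtain ⟨τ, hτ, hτ'⟩ := mem_nhdsGT_iff_exists_Ioo_subset.1 hev
  replace hτ : 0 < τ := hτ
  set τ' := min (τ / 2) (1 / 2) with hτ'def
  have hτ'0 : 0 < τ' := by positivity
  have hτ'1 : τ' < 1 := (min_le_right _ _).trans_lt (by norm_num)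
  have hsmall : ∀ t ∈ Ioc (0 : ℝ) τ', t ^ α ≤ |γ t| := by
    intro t ht
    have ht1 : t < 1 := ht.2.trans_lt hτ'1
    have htτ : t < τ := ht.2.trans_lt ((min_le_left _ _).trans_lt (by linarith))
    have hlog : Real.log t < 0 := Real.log_neg ht.1 ht1
    have h1 : Real.log |γ t| / Real.log t < α := hτ' ⟨ht.1, htτ⟩
    rw [div_lt_iff_of_neg hlog] at h1
    have hpos : 0 < |γ t| := abs_pos.2 (hne t ⟨ht.1, ht1.le⟩)
    rw [Real.rpow_def_of_pos ht.1, ← Real.exp_log hpos]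
    exact Real.exp_le_exp.2 (by linarith)
  have hsub : Icc τ' 1 ⊆ Ioc 0 1 := fun t ht => ⟨hτ'0.trans_le ht.1, ht.2⟩
  have hcont : ContinuousOn (fun t => |γ t| / t ^ α) (Icc τ' 1) := by
    refine ((hγ.continuousOn.mono hsub).abs).div ?_ ?_
    · exact continuousOn_id.rpow_const fun t ht => Or.inl (hsub ht).1.ne'
    · exact fun t ht => (Real.rpow_pos_of_pos (hsub ht).1 α).ne'
  obtain ⟨t₀, ht₀, hmin⟩ := isCompact_Icc.exists_isMinOn (nonempty_Icc.2 hτ'1.le) hcont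
  have hm : 0 < |γ t₀| / t₀ ^ α :=
    div_pos (abs_pos.2 (hne t₀ (hsub ht₀))) (Real.rpow_pos_of_pos (hsub ht₀).1 α)
  refine ⟨min 1 (|γ t₀| / t₀ ^ α), lt_min one_pos hm, fun t ht => ?_⟩
  have hpos := Real.rpow_pos_of_pos ht.1 α
  rcases le_total t τ' with h | h
  · calc _ ≤ 1 * t ^ α := by gcongr; exact min_le_left _ _
      _ = t ^ α := one_mul _
      _ ≤ _ := hsmall t ⟨ht.1, h⟩
  · calc _ ≤ |γ t₀| / t₀ ^ α * t ^ α := by gcongr; exact min_le_right _ _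
      _ ≤ |γ t| / t ^ α * t ^ α := mul_le_mul_of_nonneg_right (hmin ⟨h, ht.2⟩) hpos.le
      _ = |γ t| := div_mul_cancel₀ _ hpos.ne'

theorem exists_dyadic_curvature_bound (hγ : ContDiffOn ℝ 2 γ (Ioc 0 1))
    (hne : ∀ t ∈ Ioc (0 : ℝ) 1, γ t ≠ 0)
    (hlow₂ : ∃ c : ℝ, 0 < c ∧ ∀ t ∈ Ioc (0 : ℝ) 1,
      c ≤ |t ^ 2 * iteratedDerivWithin 2 γ (Ioc 0 1) t / γ t|)
    (hup : ∃ c : ℝ, 0 < c ∧ ∀ t ∈ Ioc (0 : ℝ) 1, |t * derivWithin γ (Ioc 0 1) t / γ t| ≤ c)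
    {α : ℝ} (hα : curveExponent γ < α) :
    ∃ c : ℝ, 0 < c ∧ ∀ k : ℕ, ∀ t ∈ Ioc ((1 / 2 : ℝ) ^ (k + 1)) ((1 / 2) ^ k),
      c * ((1 / 2 : ℝ) ^ k) ^ (α - 2) ≤ |iteratedDerivWithin 2 γ (Ioc 0 1) t| := by
  obtain ⟨c₁, hc₁, h₁⟩ := exists_mul_rpow_le_abs hγ hne hup hα
  obtain ⟨c₂, hc₂, h₂⟩ := hlow₂
  -- This is the price of replacing t^(α-2) by r^(α-2) when t/r lies in (1/2, 1], for either sign of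
  -- α - 2.
  set m := min 1 ((1 / 2 : ℝ) ^ (α - 2)) with hm
  have hm0 : 0 < m := by positivity
  refine ⟨c₂ * c₁ * m, by positivity, fun k t ht => ?_⟩
  set r : ℝ := (1 / 2) ^ k with hr
  have hr0 : 0 < r := by positivity
  have hr1 : r ≤ 1 := pow_le_one₀ (by norm_num) (by norm_num)
  have ht0 : 0 < t := lt_trans (by positivity) ht.1
  have htm : t ∈ Ioc (0 : ℝ) 1 := ⟨ht0, ht.2.trans hr1⟩
  have hratio : m ≤ (t / r) ^ (α - 2) := by
    have hle : t / r ≤ 1 := (div_le_one hr0).2 ht.2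
    have hge : 1 / 2 ≤ t / r := by
      rw [le_div_iff₀ hr0]
      have := ht.1.le
      rw [pow_succ] at this
      linarith
    rcases le_total 0 (α - 2) with h | h
    · exact (min_le_right _ _).trans (Real.rpow_le_rpow (by norm_num) hge h)
    · exact (min_le_left _ _).trans
        (Real.one_le_rpow_of_pos_of_le_one_of_nonpos (by positivity) hle h)
  have hsplit : (t / r) ^ (α - 2) * r ^ (α - 2) = t ^ (α - 2) := by
    rw [← Real.mul_rpow (by positivity) hr0.le, div_mul_cancel₀ _ hr0.ne']
  have hγ0 : 0 < |γ t| := abs_pos.2 (hne t htm)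
  have h3 := h₂ t htm
  rw [abs_div, le_div_iff₀ hγ0, abs_mul, abs_of_pos (pow_pos ht0 2)] at h3
  have h4 := h₁ t htm
  have hexp : t ^ α = t ^ 2 * t ^ (α - 2) := by
    rw [← Real.rpow_natCast, ← Real.rpow_add ht0]
    congr 1
    push_cast
    ring
  rw [hexp] at h4
  have h5 : c₂ * c₁ * t ^ (α - 2) ≤ |iteratedDerivWithin 2 γ (Ioc 0 1) t| := by
    refine le_of_mul_le_mul_left ?_ (pow_pos ht0 2)
    calc t ^ 2 * (c₂ * c₁ * t ^ (α - 2)) = c₂ * (c₁ * (t ^ 2 * t ^ (α - 2))) := by ring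
      _ ≤ c₂ * |γ t| := by gcongr
      _ ≤ _ := h3
  calc c₂ * c₁ * m * r ^ (α - 2) ≤ c₂ * c₁ * (t / r) ^ (α - 2) * r ^ (α - 2) := by gcongr
    _ = c₂ * c₁ * t ^ (α - 2) := by rw [mul_assoc, hsplit]
    _ ≤ _ := h5

end CurveRegularity

/-! ### The sufficient condition. -/

theorem measurable_indicator_of_continuousOn {γ : ℝ → ℝ} (hγ : ContinuousOn γ (Ioc 0 1)) :
    Measurable ((Ioc (0 : ℝ) 1).indicator γ) := by
  classical
  rw [← piecewise_eq_indicator]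
  exact hγ.measurable_piecewise continuousOn_const measurableSet_Ioc

theorem wellDefined_and_estimate_of_mem_triangle {γ : ℝ → ℝ}
    (hγ : ContDiffOn ℝ 2 γ (Ioc 0 1))
    (hne : ∀ t ∈ Ioc (0 : ℝ) 1, γ t ≠ 0)
    (hlow₂ : ∃ c : ℝ, 0 < c ∧ ∀ t ∈ Ioc (0 : ℝ) 1,
      c ≤ |t ^ 2 * iteratedDerivWithin 2 γ (Ioc 0 1) t / γ t|)
    (hup : ∃ c : ℝ, 0 < c ∧ ∀ t ∈ Ioc (0 : ℝ) 1, |t * derivWithin γ (Ioc 0 1) t / γ t| ≤ c)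
    {p q : ℝ≥0∞} (hp : 1 ≤ p) (hq : 0 < q)
    (htri : (p⁻¹.toReal, q⁻¹.toReal) ∈ exponentTriangle)
    (hω : 0 < 1 + (1 + curveExponent γ) * (q⁻¹.toReal - p⁻¹.toReal)) :
    WellDefinedOnLp γ p ∧ UniformLpLqEstimate γ p q := by
  have hmeas := measurable_indicator_of_continuousOn hγ.continuousOn
  have hp0 : p ≠ 0 := (zero_lt_one.trans_le hp).ne'
  obtain ⟨h₁, h₂, h₃⟩ := htri
  simp only [ENNReal.toReal_inv] at h₁ h₂ h₃ hω
  rcases eq_or_ne p ⊤ with rfl | hpt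
  · have hqt : q = ⊤ := by
      by_contra hqt
      have := inv_pos.2 (ENNReal.toReal_pos hq.ne' hqt)
      rw [ENNReal.toReal_top, inv_zero] at h₂
      linarith
    subst hqt
    exact wellDefined_and_estimate_top hmeas
  have hpp := ENNReal.toReal_pos hp0 hpt
  have hqt : q ≠ ⊤ := by
    rintro rfl
    have := inv_pos.2 hpp
    rw [ENNReal.toReal_top, inv_zero] at h₁
    linarith
  have hp1 : 1 ≤ p.toReal := by
    rw [← ENNReal.toReal_one]
    exact ENNReal.toReal_mono hpt hp
  set δ := p.toReal⁻¹ - q.toReal⁻¹ with hδ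
  have hδ0 : 0 ≤ δ := by linarith
  have hω' : 0 < 1 - (1 + curveExponent γ) * δ := by
    rw [hδ]
    linarith
  obtain ⟨α, hα, hαδ⟩ : ∃ α, curveExponent γ < α ∧ 0 < 1 - (1 + α) * δ := by
    -- Raising ω by ε costs εδ, less than half of the available slack; the 1 + δ keeps the
    -- denominator positive when δ = 0.
    set ε := (1 - (1 + curveExponent γ) * δ) / (2 * (1 + δ)) with hε
    have hε0 : 0 < ε := by positivity
    refine ⟨curveExponent γ + ε, by linarith, ?_⟩
    have : ε * (2 * (1 + δ)) = 1 - (1 + curveExponent γ) * δ := by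
      rw [hε]
      exact div_mul_cancel₀ _ (by positivity)
    nlinarith
  obtain ⟨c, hc, hcurv⟩ := exists_dyadic_curvature_bound hγ hne hlow₂ hup hα
  have hsub : ∀ k : ℕ, Ioc ((1 / 2 : ℝ) ^ (k + 1)) ((1 / 2) ^ k) ⊆ Ioc 0 1 := fun k t ht =>
    ⟨lt_trans (by positivity) ht.1, ht.2.trans (pow_le_one₀ (by norm_num) (by norm_num))⟩
  obtain ⟨C, hC, hCle⟩ := lintegral_curve_average_le (γ := (Ioc (0 : ℝ) 1).indicator γ)
    (γ' := derivWithin γ (Ioc 0 1)) hmeas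
    (fun t ht => (hasDerivWithinAt_of_contDiffOn_two hγ ht).congr
      (fun s hs => indicator_of_mem hs γ) (indicator_of_mem ht γ))
    (c := c) (σ := α - 2) hc
    (fun k => mul_abs_sub_le_abs_derivWithin_sub hγ ordConnected_Ioc (hsub k) (hcurv k))
    hp1 (ENNReal.toReal_pos hq.ne' hqt) h₁ h₂ h₃ (by linarith)
  exact wellDefined_and_estimate_of_lintegral_le hmeas hp0 hpt hq.ne' hqt hC hCle

/-! ### Test sets. -/

/-- Testing the estimate on indicator functions of sets. -/
theorem UniformLpLqEstimate.exists_measure_le {γ : ℝ → ℝ}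
    (hγ : Measurable ((Ioc (0 : ℝ) 1).indicator γ)) {p q : ℝ≥0∞} (hp : p ≠ 0) (hq : q ≠ 0)
    (h : UniformLpLqEstimate γ p q) :
    ∃ C : ℝ, 0 < C ∧ ∀ E F : Set (ℝ × ℝ), MeasurableSet E → MeasurableSet F →
      ∀ e f l : ℝ, 0 < e → 0 < f → 0 ≤ l → volume E = ENNReal.ofReal e →
        volume F = ENNReal.ofReal f →
        (∀ x ∈ F, ∃ a : ℝ, 0 ≤ a ∧ a + l ≤ 1 ∧
          ∀ t ∈ Ioc a (a + l), (x.1 - t, x.2 - γ t) ∈ E) →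
        l * f ^ q⁻¹.toReal ≤ C * e ^ p⁻¹.toReal := by
  obtain ⟨C, hC, hest⟩ := h
  refine ⟨C, hC, fun E F hE hF e f l he hf hl hvE hvF hEF => ?_⟩
  have hΓ := measurable_truncatedCurve hγ 1
  have hE0 : volume E ≠ 0 := by
    rw [hvE]
    exact (ENNReal.ofReal_pos.2 he).ne'
  have hF0 : volume F ≠ 0 := by
    rw [hvF]
    exact (ENNReal.ofReal_pos.2 hf).ne'
  have hmem : MemLp (E.indicator fun _ => (1 : ℂ)) p volume :=
    memLp_indicator_const p hE 1 (Or.inr (by rw [hvE]; exact ENNReal.ofReal_ne_top))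
  have hmain := hest 1 (by norm_num) _ hmem
  rw [eLpNorm_indicator_const' hE hE0 hp, hvE] at hmain
  have hlow : eLpNorm (F.indicator fun _ => (l : ℂ)) q volume ≤
      eLpNorm (fun x => curveAverage γ (E.indicator fun _ => (1 : ℂ)) x 1) q volume := by
    refine eLpNorm_mono fun x => ?_
    by_cases hx : x ∈ F
    · rw [indicator_of_mem hx, curveAverage, intervalIntegral.integral_of_le zero_le_one]
      have hTm : MeasurableSet {t | x - truncatedCurve γ 1 t ∈ E} :=
        (measurable_const.sub hΓ) hE
      have heq : ∫ t in Ioc (0 : ℝ) 1, alongCurve γ (E.indicator fun _ => (1 : ℂ)) x 1 t =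
          ∫ t in Ioc (0 : ℝ) 1, {t | x - truncatedCurve γ 1 t ∈ E}.indicator
            (fun _ => (1 : ℂ)) t := by
        refine setIntegral_congr_fun measurableSet_Ioc fun t ht => ?_
        rw [alongCurve_eq_truncatedCurve γ _ x 1 ht]
        rfl
      rw [heq, integral_indicator_const _ hTm, norm_smul, norm_one, mul_one,
        Complex.norm_real, Real.norm_of_nonneg hl, Real.norm_of_nonneg measureReal_nonneg]
      obtain ⟨a, ha, hal, hmem⟩ := hEF x hx
      have hsub : Ioc a (a + l) ⊆ {t | x - truncatedCurve γ 1 t ∈ E} ∩ Ioc 0 1 := by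
        intro t ht
        have ht' : t ∈ Ioc (0 : ℝ) 1 := ⟨ha.trans_lt ht.1, ht.2.trans hal⟩
        refine ⟨?_, ht'⟩
        have := hmem t ht
        simp only [truncatedCurve, indicator_of_mem ht', one_mul, mem_ofPred_eq]
        exact this
      rw [measureReal_restrict_apply hTm]
      have hfin : volume ({t | x - truncatedCurve γ 1 t ∈ E} ∩ Ioc 0 1) ≠ ⊤ :=
        measure_ne_top_of_subset inter_subset_right (by simp)
      have := measureReal_mono hsub hfin
      rwa [Real.volume_real_Ioc_of_le (by linarith), add_sub_cancel_left] at this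
    · rw [indicator_of_notMem hx, norm_zero]
      exact norm_nonneg _
  rw [eLpNorm_indicator_const' hF hF0 hq, hvF] at hlow
  have htot := hlow.trans hmain
  rw [enorm_one, one_mul, ← ofReal_norm, Complex.norm_real, Real.norm_of_nonneg hl,
    ENNReal.ofReal_rpow_of_pos hf, ENNReal.ofReal_rpow_of_pos he, ← ENNReal.ofReal_mul hl,
    ← ENNReal.ofReal_mul hC.le, ENNReal.ofReal_le_ofReal_iff (by positivity)] at htot
  simpa only [ENNReal.toReal_inv, one_div] using htot

/-- The box `[-r, r] × [-s, s]`. -/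
def centeredBox (r s : ℝ) : Set (ℝ × ℝ) := Icc (-r) r ×ˢ Icc (-s) s

theorem measurableSet_centeredBox (r s : ℝ) : MeasurableSet (centeredBox r s) :=
  measurableSet_Icc.prod measurableSet_Icc

theorem mem_centeredBox {r s : ℝ} {x : ℝ × ℝ} : x ∈ centeredBox r s ↔ |x.1| ≤ r ∧ |x.2| ≤ s := by
  rw [centeredBox, mem_prod, mem_Icc, mem_Icc, abs_le, abs_le]

theorem volume_centeredBox {r s : ℝ} (hr : 0 ≤ r) :
    volume (centeredBox r s) = ENNReal.ofReal (4 * r * s) := by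
  rw [centeredBox, Measure.volume_eq_prod, Measure.prod_prod, Real.volume_Icc, Real.volume_Icc,
    ← ENNReal.ofReal_mul (by linarith)]
  congr 1
  ring

/-- The vertical `δ`-neighbourhood of the part of the graph of `γ` over `[1/2, 1]`. -/
def graphStrip (γ : ℝ → ℝ) (δ : ℝ) : Set (ℝ × ℝ) :=
  regionBetween (fun t => (Ioc (0 : ℝ) 1).indicator γ t - δ)
    (fun t => (Ioc (0 : ℝ) 1).indicator γ t + δ) (Icc (1 / 2) 1)

theorem measurableSet_graphStrip {γ : ℝ → ℝ} (hγ : Measurable ((Ioc (0 : ℝ) 1).indicator γ))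
    (δ : ℝ) : MeasurableSet (graphStrip γ δ) :=
  measurableSet_regionBetween (hγ.sub_const δ) (hγ.add_const δ) measurableSet_Icc

theorem mem_graphStrip {γ : ℝ → ℝ} {δ : ℝ} {x : ℝ × ℝ} :
    x ∈ graphStrip γ δ ↔ x.1 ∈ Icc (1 / 2 : ℝ) 1 ∧ |x.2 - γ x.1| < δ := by
  simp only [graphStrip, regionBetween, mem_ofPred_eq]
  refine and_congr_right fun hx => ?_
  rw [indicator_of_mem (show x.1 ∈ Ioc (0 : ℝ) 1 from ⟨by linarith [hx.1], hx.2⟩), abs_lt, mem_Ioo]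
  constructor <;> rintro ⟨h1, h2⟩ <;> constructor <;> linarith

theorem volume_graphStrip {γ : ℝ → ℝ} (hγ : Measurable ((Ioc (0 : ℝ) 1).indicator γ)) {δ : ℝ}
    (hδ : 0 ≤ δ) : volume (graphStrip γ δ) = ENNReal.ofReal δ := by
  rw [graphStrip, Measure.volume_eq_prod, volume_regionBetween_eq_lintegral
    (hγ.sub_const δ).aemeasurable (hγ.add_const δ).aemeasurable measurableSet_Icc]
  simp only [Pi.sub_apply, add_sub_sub_cancel, lintegral_const, Measure.restrict_apply_univ,
    Real.volume_Icc]
  rw [← ENNReal.ofReal_mul (by linarith)]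
  congr 1
  ring

theorem exponent_le_of_forall_mul_rpow_le {x y c K δ₀ : ℝ} (hc : 0 < c) (hδ₀ : 0 < δ₀)
    (h : ∀ δ : ℝ, 0 < δ → δ ≤ δ₀ → c * δ ^ x ≤ K * δ ^ y) : y ≤ x := by
  by_contra! hxy
  have hlim : Tendsto (fun δ : ℝ => K * δ ^ (y - x)) (𝓝[>] 0) (𝓝 (K * 0)) := by
    refine Tendsto.const_mul K ?_
    have := (Real.continuous_rpow_const (q := y - x) (by linarith)).tendsto 0
    rw [Real.zero_rpow (by linarith)] at this
    exact this.mono_left nhdsWithin_le_nhds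
  have : c ≤ K * 0 := by
    refine ge_of_tendsto hlim ?_
    filter_upwards [Ioo_mem_nhdsGT hδ₀] with δ hδ
    have hpos := Real.rpow_pos_of_pos hδ.1 x
    refine le_of_mul_le_mul_right ?_ hpos
    rw [mul_assoc, ← Real.rpow_add hδ.1, sub_add_cancel]
    exact h δ hδ.1 hδ.2.le
  linarith

/-! ### The necessary conditions. -/

section Necessity

variable {γ : ℝ → ℝ}

theorem abs_le_abs_of_monotoneOn_or_antitoneOn (hlim : Tendsto γ (𝓝[>] 0) (𝓝 0))
    (hmono : MonotoneOn γ (Ioc 0 1) ∨ AntitoneOn γ (Ioc 0 1)) {s t : ℝ} (hs : 0 < s)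
    (hst : s ≤ t) (ht : t ≤ 1) : |γ s| ≤ |γ t| := by
  have hsm : s ∈ Ioc (0 : ℝ) 1 := ⟨hs, hst.trans ht⟩
  have htm : t ∈ Ioc (0 : ℝ) 1 := ⟨hs.trans_le hst, ht⟩
  rcases hmono with h | h
  · have h0 : 0 ≤ γ s := by
      refine le_of_tendsto hlim ?_
      filter_upwards [Ioo_mem_nhdsGT hs] with r hr
      exact h ⟨hr.1, hr.2.le.trans hsm.2⟩ hsm hr.2.le
    have h1 := h hsm htm hst
    rwa [abs_of_nonneg h0, abs_of_nonneg (h0.trans h1)]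
  · have h0 : γ s ≤ 0 := by
      refine ge_of_tendsto hlim ?_
      filter_upwards [Ioo_mem_nhdsGT hs] with r hr
      exact h ⟨hr.1, hr.2.le.trans hsm.2⟩ hsm hr.2.le
    have h1 := h hsm htm hst
    rw [abs_of_nonpos h0, abs_of_nonpos (h1.trans h0)]
    linarith

theorem exists_lipschitz_bound (hγ : ContDiffOn ℝ 2 γ (Ioc 0 1)) :
    ∃ L : ℝ, 0 ≤ L ∧ ∀ s ∈ Icc (1 / 4 : ℝ) 1, ∀ t ∈ Icc (1 / 4 : ℝ) 1,
      |γ s - γ t| ≤ L * |s - t| := by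
  have hsub : Icc (1 / 4 : ℝ) 1 ⊆ Ioc 0 1 := fun t ht => ⟨by linarith [ht.1], ht.2⟩
  have hcont : ContinuousOn (derivWithin γ (Ioc 0 1)) (Icc (1 / 4) 1) := fun t ht =>
    (hasDerivWithinAt_derivWithin_of_contDiffOn_two hγ (hsub ht)).continuousWithinAt.mono hsub
  obtain ⟨L, hL⟩ := isCompact_Icc.exists_bound_of_continuousOn hcont
  refine ⟨L, (norm_nonneg _).trans (hL 1 (by norm_num)), fun s hs t ht => ?_⟩
  exact (convex_Icc (1 / 4 : ℝ) 1).norm_image_sub_le_of_norm_hasDerivWithin_le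
    (fun r hr => (hasDerivWithinAt_of_contDiffOn_two hγ (hsub hr)).mono hsub) hL ht hs

variable {p q : ℝ≥0∞}

/-- The curve is bounded, so on a box of half-side R the average of the indicator of a slightly
larger box is 1. Both areas grow like R²; let R → ∞ with δ = 1/R. -/
theorem UniformLpLqEstimate.inv_le_inv (hγ : Measurable ((Ioc (0 : ℝ) 1).indicator γ))
    (hp : p ≠ 0) (hq : q ≠ 0) {M : ℝ} (hM0 : 0 ≤ M) (hM : ∀ t ∈ Ioc (0 : ℝ) 1, |γ t| ≤ M)
    (h : UniformLpLqEstimate γ p q) : q⁻¹.toReal ≤ p⁻¹.toReal := by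
  obtain ⟨C, hC, hest⟩ := h.exists_measure_le hγ hp hq
  set a := p⁻¹.toReal with ha
  set b := q⁻¹.toReal with hb
  have ha0 : 0 ≤ a := ENNReal.toReal_nonneg
  suffices -2 * a ≤ -2 * b by linarith
  refine exponent_le_of_forall_mul_rpow_le (c := 4 ^ b) (K := C * (8 * (1 + M)) ^ a) (δ₀ := 1)
    (by positivity) one_pos fun δ hδ hδ1 => ?_
  set R := δ⁻¹ with hR
  have hR0 : 0 < R := inv_pos.2 hδ
  have hR1 : 1 ≤ R := (one_le_inv₀ hδ).2 hδ1
  have hmain := hest (centeredBox (R + 1) (R + M)) (centeredBox R R) (measurableSet_centeredBox _ _)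
    (measurableSet_centeredBox _ _) (4 * (R + 1) * (R + M)) (4 * R * R) 1 (by positivity)
    (by positivity) zero_le_one (volume_centeredBox (by positivity)) (volume_centeredBox hR0.le) ?_
  · have hexp : ∀ z : ℝ, δ ^ (-2 * z) = (R ^ 2) ^ z := by
      intro z
      rw [← Real.rpow_natCast R, ← Real.rpow_mul hR0.le, hR, Real.inv_rpow hδ.le,
        ← Real.rpow_neg hδ.le]
      congr 1
      push_cast
      ring
    rw [hexp, hexp, ← Real.mul_rpow (by norm_num) (by positivity), mul_assoc,
      ← Real.mul_rpow (by positivity) (by positivity)]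
    calc (4 * R ^ 2) ^ b = 1 * (4 * R * R) ^ b := by rw [one_mul]; congr 1; ring
      _ ≤ _ := hmain
      _ ≤ C * (8 * (1 + M) * R ^ 2) ^ a := by
        have : R + M ≤ (1 + M) * R := by nlinarith
        refine mul_le_mul_of_nonneg_left (Real.rpow_le_rpow (by positivity) ?_ ha0) hC.le
        calc 4 * (R + 1) * (R + M) ≤ 4 * (R + R) * ((1 + M) * R) := by gcongr
          _ = _ := by ring
  · intro x hx
    rw [mem_centeredBox] at hx
    refine ⟨0, le_rfl, by norm_num, fun t ht => mem_centeredBox.2 ⟨?_, ?_⟩⟩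
    · rw [zero_add] at ht
      refine (abs_sub _ _).trans (add_le_add hx.1 ?_)
      rw [abs_of_pos ht.1]
      exact ht.2
    · rw [zero_add] at ht
      exact (abs_sub _ _).trans (add_le_add hx.2 (hM t ht))

/-- The average of the indicator of a box of size δ is at least δ on a δ-neighbourhood of the curve,
so δ · δ^(1/q) ≲ δ^(2/p). -/
theorem UniformLpLqEstimate.two_mul_inv_sub_one_le (hγ : ContDiffOn ℝ 2 γ (Ioc 0 1))
    (hp : p ≠ 0) (hq : q ≠ 0) (h : UniformLpLqEstimate γ p q) :
    2 * p⁻¹.toReal - 1 ≤ q⁻¹.toReal := by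
  have hγm := measurable_indicator_of_continuousOn hγ.continuousOn
  obtain ⟨C, hC, hest⟩ := h.exists_measure_le hγm hp hq
  obtain ⟨L, hL0, hL⟩ := exists_lipschitz_bound hγ
  set a := p⁻¹.toReal with ha
  set b := q⁻¹.toReal with hb
  suffices 2 * a ≤ 1 + b by linarith
  -- With δ ≤ 1/4 and x₁ ≥ 1/2 the window (x₁ - δ, x₁] stays where the Lipschitz bound holds.
  refine exponent_le_of_forall_mul_rpow_le (c := 1) (K := C * (4 * (1 + L)) ^ a) (δ₀ := 1 / 4)
    one_pos (by norm_num) fun δ hδ hδ1 => ?_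
  have hmain := hest (centeredBox δ ((1 + L) * δ)) (graphStrip γ δ) (measurableSet_centeredBox _ _)
    (measurableSet_graphStrip hγm δ) (4 * δ * ((1 + L) * δ)) δ δ (by positivity)
    hδ hδ.le (volume_centeredBox hδ.le) (volume_graphStrip hγm hδ.le) ?_
  · rw [one_mul, Real.rpow_add hδ, Real.rpow_one, mul_assoc, Real.rpow_mul hδ.le,
      ← Real.mul_rpow (by positivity) (by positivity)]
    refine hmain.trans (le_of_eq ?_)
    congr 2
    rw [show (2 : ℝ) = (2 : ℕ) by norm_num, Real.rpow_natCast]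
    ring
  · intro x hx
    obtain ⟨hx1, hx2⟩ := mem_graphStrip.1 hx
    refine ⟨x.1 - δ, by linarith [hx1.1], by linarith [hx1.2], fun t ht => ?_⟩
    have ht2 : t ≤ x.1 := by linarith [ht.2]
    have hd : |x.1 - t| ≤ δ := by
      rw [abs_of_nonneg (by linarith)]
      linarith [ht.1]
    refine mem_centeredBox.2 ⟨hd, ?_⟩
    have hLip := hL x.1 ⟨by linarith [hx1.1], hx1.2⟩ t
      ⟨by linarith [ht.1, hx1.1], by linarith [hx1.2]⟩
    calc |x.2 - γ t| ≤ |x.2 - γ x.1| + |γ x.1 - γ t| := abs_sub_le _ _ _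
      _ ≤ δ + L * δ := add_le_add hx2.le (hLip.trans (by gcongr))
      _ = (1 + L) * δ := by ring

/-- The converse configuration: for x within δ of 0, the reflected curve through x stays in a
neighbourhood of the reflected curve of width O(δ) for a fixed length of time, so δ^(2/q) ≲ δ^(1/p).
-/
theorem UniformLpLqEstimate.half_inv_le (hγ : ContDiffOn ℝ 2 γ (Ioc 0 1))
    (hp : p ≠ 0) (hq : q ≠ 0) (h : UniformLpLqEstimate γ p q) :
    p⁻¹.toReal / 2 ≤ q⁻¹.toReal := by
  have hγm := measurable_indicator_of_continuousOn hγ.continuousOn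
  obtain ⟨C, hC, hest⟩ := h.exists_measure_le hγm hp hq
  obtain ⟨L, hL0, hL⟩ := exists_lipschitz_bound hγ
  set a := p⁻¹.toReal with ha
  set b := q⁻¹.toReal with hb
  suffices a ≤ 2 * b by linarith
  refine exponent_le_of_forall_mul_rpow_le (c := 1 / 4 * 4 ^ b) (K := C * (2 + L) ^ a) (δ₀ := 1 / 8)
    (by positivity) (by norm_num) fun δ hδ hδ1 => ?_
  have hmain := hest (Neg.neg ⁻¹' graphStrip γ ((2 + L) * δ)) (centeredBox δ δ)
    (measurable_neg (measurableSet_graphStrip hγm _)) (measurableSet_centeredBox _ _)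
    ((2 + L) * δ) (4 * δ * δ) (1 / 4) (by positivity) (by positivity) (by norm_num)
    (by rw [Measure.measure_preimage_neg, volume_graphStrip hγm (by positivity)])
    (volume_centeredBox hδ.le) ?_
  · rw [mul_assoc, mul_assoc, ← Real.mul_rpow (by positivity) hδ.le, Real.rpow_mul hδ.le,
      ← Real.mul_rpow (by positivity) (by positivity)]
    refine le_trans (le_of_eq ?_) hmain
    congr 2
    rw [show (2 : ℝ) = (2 : ℕ) by norm_num, Real.rpow_natCast]
    ring
  · intro x hx
    obtain ⟨hx1, hx2⟩ := mem_centeredBox.1 hx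
    -- For t in (5/8, 7/8] and |x₁| ≤ 1/8, the point t - x₁ lies in [1/2, 1], the base of the strip.
    refine ⟨5 / 8, by norm_num, by norm_num, fun t ht => ?_⟩
    have h1 := neg_abs_le x.1
    have h2 := le_abs_self x.1
    have ht1 : 5 / 8 < t := ht.1
    have ht2 : t ≤ 7 / 8 := by linarith [ht.2]
    have hs : t - x.1 ∈ Icc (1 / 2 : ℝ) 1 := ⟨by linarith, by linarith⟩
    refine mem_graphStrip.2 ⟨?_, ?_⟩
    · simpa using hs
    · have hLip := hL (t) ⟨by linarith, by linarith⟩ (t - x.1) ⟨by linarith [hs.1], hs.2⟩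
      rw [sub_sub_cancel] at hLip
      have he : (-(x.1 - t, x.2 - γ t) : ℝ × ℝ).2 - γ (-(x.1 - t, x.2 - γ t) : ℝ × ℝ).1 =
          (γ t - γ (t - x.1)) - x.2 := by
        simp only [Prod.neg_mk, neg_sub]
        ring
      rw [he]
      calc |γ t - γ (t - x.1) - x.2| ≤ |γ t - γ (t - x.1)| + |x.2| := abs_sub _ _
        _ ≤ L * δ + δ := add_le_add (hLip.trans (by gcongr)) hx2
        _ < (2 + L) * δ := by linarith

/-- By monotonicity of |γ|, the curve over (0, ε] lies in the box ε × |γ(ε)|. Testing on this box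
and its double gives ε ≲ (ε|γ(ε)|)^δ; taking logarithms and dividing by log ε < 0 bounds the
quotient, the constants contributing O(1/|log ε|). -/
theorem UniformLpLqEstimate.curveExponent_le (hγ : Measurable ((Ioc (0 : ℝ) 1).indicator γ))
    (hlim : Tendsto γ (𝓝[>] 0) (𝓝 0))
    (hmono : MonotoneOn γ (Ioc 0 1) ∨ AntitoneOn γ (Ioc 0 1))
    (hne : ∀ t ∈ Ioc (0 : ℝ) 1, γ t ≠ 0) (hp : p ≠ 0) (hq : q ≠ 0)
    (hpq : q⁻¹.toReal < p⁻¹.toReal) (h : UniformLpLqEstimate γ p q) :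
    curveExponent γ ≤ (p⁻¹.toReal - q⁻¹.toReal)⁻¹ - 1 := by
  obtain ⟨C, hC, hest⟩ := h.exists_measure_le hγ hp hq
  set a := p⁻¹.toReal with ha
  set b := q⁻¹.toReal with hb
  set δ := a - b with hδ
  have hδ0 : 0 < δ := sub_pos.2 hpq
  set K := Real.log C + a * Real.log 16 - b * Real.log 4 with hK
  have hsmall : ∀ᶠ t : ℝ in 𝓝[>] 0, |γ t| < 1 := by
    have := hlim.abs
    rw [abs_zero] at this
    exact this.eventually_lt_const one_pos
  have hIoo : ∀ᶠ t : ℝ in 𝓝[>] 0, t ∈ Ioo (0 : ℝ) 1 := Ioo_mem_nhdsGT one_pos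
  -- The quotient is eventually nonnegative, which is what comparing real limsups requires here.
  have hcob : IsCoboundedUnder (· ≤ ·) (𝓝[>] 0) fun t : ℝ => Real.log |γ t| / Real.log t := by
    refine IsBoundedUnder.isCoboundedUnder_le ⟨0, ?_⟩
    rw [eventually_map]
    filter_upwards [hsmall, hIoo] with t h1 h2
    exact div_nonneg_of_nonpos (Real.log_nonpos (abs_nonneg _) h1.le)
      (Real.log_nonpos h2.1.le h2.2.le)
  have hlimit : Tendsto (fun t : ℝ => δ⁻¹ * (1 - K * (Real.log t)⁻¹) - 1) (𝓝[>] 0)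
      (𝓝 (δ⁻¹ - 1)) := by
    have h1 : Tendsto (fun t : ℝ => (Real.log t)⁻¹) (𝓝[>] 0) (𝓝 0) :=
      tendsto_inv_atBot_zero.comp Real.tendsto_log_nhdsGT_zero
    have h2 := ((h1.const_mul K).const_sub 1).const_mul δ⁻¹ |>.sub_const 1
    simpa using h2
  rw [← hlimit.limsup_eq]
  refine limsup_le_limsup ?_ hcob hlimit.isBoundedUnder_le
  filter_upwards [hIoo] with ε hε
  have hγ0 : 0 < |γ ε| := abs_pos.2 (hne ε ⟨hε.1, hε.2.le⟩)
  have hlog : Real.log ε < 0 := Real.log_neg hε.1 hε.2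
  have hmain := hest (centeredBox (2 * ε) (2 * |γ ε|)) (centeredBox ε |γ ε|)
    (measurableSet_centeredBox _ _) (measurableSet_centeredBox _ _)
    (4 * (2 * ε) * (2 * |γ ε|)) (4 * ε * |γ ε|) ε (mul_pos (by linarith [hε.1]) (by positivity))
    (mul_pos (by linarith [hε.1]) hγ0) hε.1.le
    (volume_centeredBox (by linarith [hε.1])) (volume_centeredBox hε.1.le) ?_
  · have hε0 := hε.1
    have hlogmul : ∀ c : ℝ, c ≠ 0 →
        Real.log (c * (ε * |γ ε|)) = Real.log c + (Real.log ε + Real.log |γ ε|) := fun c hc => by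
      rw [Real.log_mul hc (by positivity), Real.log_mul hε0.ne' hγ0.ne']
    have hle := Real.log_le_log (by positivity) hmain
    rw [Real.log_mul (by positivity) (by positivity), Real.log_mul (by positivity) (by positivity),
      Real.log_rpow (by positivity), Real.log_rpow (by positivity),
      show 4 * (2 * ε) * (2 * |γ ε|) = 16 * (ε * |γ ε|) by ring,
      show 4 * ε * |γ ε| = 4 * (ε * |γ ε|) by ring, hlogmul 4 (by norm_num),
      hlogmul 16 (by norm_num)] at hle
    set l := Real.log ε
    set g := Real.log |γ ε|
    have h1 : l - δ * (l + g) ≤ K := by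
      rw [hδ, hK]
      linarith
    have h2 : δ⁻¹ * (1 - K * l⁻¹) - 1 = (δ⁻¹ * (l - K) - l) / l := by
      rw [sub_div, mul_div_assoc, sub_div, div_self hlog.ne, div_eq_mul_inv K]
    change g / l ≤ δ⁻¹ * (1 - K * l⁻¹) - 1
    rw [h2]
    refine div_le_div_of_nonpos_of_le hlog.le ?_
    have h3 : δ⁻¹ * (l - K) ≤ l + g := by
      rw [inv_mul_le_iff₀ hδ0]
      linarith
    linarith
  · intro x hx
    obtain ⟨hx1, hx2⟩ := mem_centeredBox.1 hx
    refine ⟨0, le_rfl, by linarith [hε.2], fun t ht => mem_centeredBox.2 ⟨?_, ?_⟩⟩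
    · rw [zero_add] at ht
      refine (abs_sub _ _).trans ?_
      rw [abs_of_pos ht.1]
      linarith [ht.2]
    · rw [zero_add] at ht
      have := abs_le_abs_of_monotoneOn_or_antitoneOn hlim hmono ht.1 ht.2 hε.2.le
      refine (abs_sub _ _).trans ?_
      linarith

end Necessity

theorem theorem3 (γ : ℝ → ℝ)
    (hγ : ContDiffOn ℝ 2 γ (Ioc 0 1))
    (hlim : Tendsto γ (𝓝[>] 0) (𝓝 0))
    (hmono : MonotoneOn γ (Ioc 0 1) ∨ AntitoneOn γ (Ioc 0 1))
    (hlow₁ : ∃ c : ℝ, 0 < c ∧ ∀ t ∈ Ioc (0 : ℝ) 1,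
      c ≤ |t * derivWithin γ (Ioc 0 1) t / γ t|)
    (hlow₂ : ∃ c : ℝ, 0 < c ∧ ∀ t ∈ Ioc (0 : ℝ) 1,
      c ≤ |t ^ 2 * iteratedDerivWithin 2 γ (Ioc 0 1) t / γ t|)
    (hup₁ : ∃ c : ℝ, 0 < c ∧ ∀ t ∈ Ioc (0 : ℝ) 1,
      |t * derivWithin γ (Ioc 0 1) t / γ t| ≤ c)
    (p q : ℝ≥0∞) (hp : 1 ≤ p) (hq : 0 < q) :
    (((p⁻¹.toReal, q⁻¹.toReal) ∈ exponentTriangle ∧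
        0 < 1 + (1 + curveExponent γ) * (q⁻¹.toReal - p⁻¹.toReal)) →
      WellDefinedOnLp γ p ∧ UniformLpLqEstimate γ p q) ∧
    (UniformLpLqEstimate γ p q →
      (p⁻¹.toReal, q⁻¹.toReal) ∈ exponentTriangle ∧
        0 ≤ 1 + (1 + curveExponent γ) * (q⁻¹.toReal - p⁻¹.toReal)) := by
  have hne : ∀ t ∈ Ioc (0 : ℝ) 1, γ t ≠ 0 := fun t ht =>
    ne_zero_of_le_abs_mul_derivWithin_div hlow₁ ht
  have hp0 : p ≠ 0 := (zero_lt_one.trans_le hp).ne'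
  have hγm := measurable_indicator_of_continuousOn hγ.continuousOn
  refine ⟨fun h => wellDefined_and_estimate_of_mem_triangle hγ hne hlow₂ hup₁ hp hq h.1 h.2,
    fun h => ?_⟩
  have hle : q⁻¹.toReal ≤ p⁻¹.toReal :=
    h.inv_le_inv hγm hp0 hq.ne' (abs_nonneg (γ 1)) fun t ht =>
      abs_le_abs_of_monotoneOn_or_antitoneOn hlim hmono ht.1 ht.2 le_rfl
  refine ⟨⟨h.half_inv_le hγ hp0 hq.ne', hle, h.two_mul_inv_sub_one_le hγ hp0 hq.ne'⟩, ?_⟩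
  rcases hle.eq_or_lt with heq | hlt
  · rw [heq]
    simp
  · have hω := h.curveExponent_le hγm hlim hmono hne hp0 hq.ne' hlt
    have hδ : 0 < p⁻¹.toReal - q⁻¹.toReal := sub_pos.2 hlt
    have h1 : (1 + curveExponent γ) * (p⁻¹.toReal - q⁻¹.toReal) ≤ 1 := by
      rw [← le_div_iff₀ hδ, one_div]
      linarith
    linarith
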